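/- **Setting.** Let $\mathcal M=(\mathcal S,\mathcal A,P,\mathcal R,H)$, $H\ge 1$, be an episodic MDP with an initial state distribution, transition kernels $P_h(\cdot\mid s,a)$, $h\in[H]$, and rewards $r_h\sim\mathcal R(s_h,a_h)\in[0,1]$. The spaces $\mathcal S,\mathcal A$ are measurable spaces, and the diagonal of $\mathcal A\times\mathcal A$ is measurable (e.g. $\mathcal A$ countable). A Markovian policy is $\pi=(\pi_1,\dots,\pi_H)$ with Markov kernels $\pi_h:\mathcal S\to\Delta(\mathcal A)$ (a stationary policy is the case where $\pi_h$ does not depend on $h$). Write $\mathbb P^\pi$ for the law of the trajectory $(s_h,a_h,r_h)_{h=1}^H$ under $\pi$, $J(\pi)=\mathbb E^\pi[\sum_h r_h]$, $V_h^\pi$ and $Q_h^\pi$ for the value functions, and $d^\pi$ for the law of $(h,s_h)$ when $h$ is uniform on $[H]$ and $(s_1,\dots,s_H)$ comes from running $\pi$. Let $R$ be such that $\sum_{h}r_h\in[0,R]$ almost surely under every Markovian policy. Let $\mathcal B$ be a finite class of Markovian policies, of size $B$, that contains the expert policy $\pi^{\mathrm E}$, which is deterministic. Assume that $(\mathcal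 M,\pi^{\mathrm E})$ is $\mu$-recoverable, i.e. $V_h^{\pi^{\mathrm E}}(s)-Q_h^{\pi^{\mathrm E}}(s,a)\le\mu$ for all $h,s,a$. Let $\tilde B$ be the size of the each-step completion $\tilde{\mathcal B}=\{(\pi_1,\dots,\pi_H):\pi_h\in\mathcal B_h\ \forall h\}$, where $\mathcal B_h=\{\pi_h:\pi\in\mathcal B\}$. **Algorithm (Warm-Stagger).** Let $N_{\mathrm{off}},N_{\mathrm{int}}\ge1$. Given $N_{\mathrm{off}}$ i.i.d. reward-free trajectories $(s_{i,h},a_{i,h})_{h=1}^H$ of $\pi^{\mathrm E}$, let $\mathcal B_{\mathrm{bc}}$ be the set of all $\pi\in\mathcal B$ such that $\pi_h(\cdot\mid s_{i,h})$ is the point mass at $a_{i,h}$ for all $i,h$, and let $B_{\mathrm{bc}}=|\mathcal B_{\mathrm{bc}}|$. For $n=1,\dots,N_{\mathrm{int}}$: play the each-step mixing policy $\pi^n_h(\cdot\mid s)=\sum_{\pi\in\mathcal B_{\mathrm{bc}}}u^n(\pi)\,\pi_h(\cdot\mid s)$, where $u^n$ is given by exponential weights with learning rate $1$ on $\mathcal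 B_{\mathrm{bc}}$ for the log loss, i.e. $u^n(\pi)\propto\exp(-\sum_{m<n}\ell^m(\pi))$ for $\pi\in\mathcal B_{\mathrm{bc}}$; sample $(h^n,s^n)\sim d^{\pi^n}$; query the expert for $a^{*,n}=\pi^{\mathrm E}_{h^n}(s^n)$; and set $\ell^n(\pi)=\log\bigl(1/\pi_{h^n}(a^{*,n}\mid s^n)\bigr)\in[0,\infty]$. The output $\hat\pi$ is the first-step uniform mixture of $\pi^1,\dots,\pi^{N_{\mathrm{int}}}$: one of them is drawn uniformly at random and run for the whole episode. **Theorem.** There is a universal constant $c>0$ such that in the above setting, for every $\delta\in(0,1)$, with probability at least $1-\delta$ (over the offline trajectories and the interaction) $$J(\pi^{\mathrm E})-J(\hat\pi)\;\le\;c\,\min\left(\frac{R\log(\tilde B/\delta)}{N_{\mathrm{off}}},\ \frac{\mu H\log(B_{\mathrm{bc}}/\delta)}{N_{\mathrm{int}}}\right).$$ Moreover $B\le\tilde B\le B^H$ and always $B_{\mathrm{bc}}\le B$. -/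

import Mathlib

open MeasureTheory ProbabilityTheory
open scoped ENNReal

namespace HybridIL

section Definitions

variable {S A : Type*} [MeasurableSpace S] [MeasurableSpace A] {H : ℕ}

/-- An episodic MDP with state space `S`, action space `A` and `H` steps (the `h`-th of the
steps `1, …, H` is the element `h - 1` of `Fin H`): an initial state
distribution, transition kernels `P_h`, and reward distributions on `[0, 1]`.
The last transition kernel is never observable. -/
structure MDP (S A : Type*) [MeasurableSpace S] [MeasurableSpace A] (H : ℕ) where
  init : Measure S
  init_prob : IsProbabilityMeasure init
  trans : Fin H → Kernel (S × A) S
  trans_markov : ∀ h, IsMarkovKernel (trans h)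
  reward : Kernel (S × A) unitInterval
  reward_markov : IsMarkovKernel reward

attribute [instance] MDP.init_prob MDP.trans_markov MDP.reward_markov

/-- A one-step decision rule: a Markov kernel from states to actions. -/
abbrev Rule (S A : Type*) [MeasurableSpace S] [MeasurableSpace A] : Type _ :=
  {κ : Kernel S A // IsMarkovKernel κ}

instance (κ : Rule S A) : IsMarkovKernel κ.1 := κ.2

/-- A Markovian policy `(π_1, …, π_H)`. A stationary policy is one that is constant in `h`. -/
abbrev Policy (S A : Type*) [MeasurableSpace S] [MeasurableSpace A] (H : ℕ) : Type _ :=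
  Fin H → Rule S A

/-- The deterministic policy that plays `e h s` in state `s` at step `h`. -/
noncomputable def deterministicPolicy (e : Fin H → S → A) (he : ∀ h, Measurable (e h)) :
    Policy S A H :=
  fun h => ⟨Kernel.deterministic (e h) (he h), inferInstance⟩

/-- A policy that ignores the state; only its existence matters. -/
instance [Nonempty A] : Nonempty (Policy S A H) :=
  ⟨fun _ => ⟨Kernel.const S (Measure.dirac (Classical.arbitrary A)), inferInstance⟩⟩

/-- A trajectory of `n` steps: the triples (state, action, reward). -/
abbrev Traj (S A : Type*) (n : ℕ) : Type _ := Fin n → S × A × unitInterval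

/-- Take action `a` in state `s` at step `h`, receive a reward, move to the next state, and let
`T` be the law of the rest of the trajectory as a function of the next state: the law of the
resulting trajectory. -/
noncomputable def prependStep (M : MDP S A H) (h : Fin H) {k : ℕ}
    (T : S → Measure (Traj S A k)) (s : S) (a : A) : Measure (Traj S A (k + 1)) :=
  (M.reward (s, a)).bind fun r =>
    (M.trans h (s, a)).bind fun s' =>
      (T s').map fun τ => (Fin.cons (s, a, r) τ : Traj S A (k + 1))

/-- The law of the trajectory `(s_i, a_i, r_i)`, `h ≤ i < h + k`, when `s_h = s` and `π` is
followed. -/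
noncomputable def rollout (M : MDP S A H) (π : Policy S A H) :
    (k h : ℕ) → h + k ≤ H → S → Measure (Traj S A k)
  | 0, _, _, _ => Measure.dirac (fun i => i.elim0)
  | k + 1, h, hk, s =>
      ((π ⟨h, by omega⟩).1 s).bind fun a =>
        prependStep M ⟨h, by omega⟩ (rollout M π k (h + 1) (by omega)) s a

/-- `P^π`, the law of the whole trajectory when `π` is run from the initial distribution. -/
noncomputable def trajLaw (M : MDP S A H) (π : Policy S A H) : Measure (Traj S A H) :=
  M.init.bind (rollout M π H 0 (by omega))

/-- The sum of the rewards along a trajectory. -/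
def totalReward {n : ℕ} (τ : Traj S A n) : ℝ := ∑ i, ((τ i).2.2 : ℝ)

/-- The expected total reward under a law of trajectories. -/
noncomputable def expectedReturn {n : ℕ} (P : Measure (Traj S A n)) : ℝ :=
  ∫ τ, totalReward τ ∂P

/-- `J(π)`. -/
noncomputable def J (M : MDP S A H) (π : Policy S A H) : ℝ := expectedReturn (trajLaw M π)

/-- `V_h^π(s)`: the expected reward collected from step `h` on when `s_h = s`. -/
noncomputable def V (M : MDP S A H) (π : Policy S A H) (h : Fin H) (s : S) : ℝ :=
  expectedReturn (rollout M π (H - h) h (by omega) s)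

/-- `Q_h^π(s, a)`: the expected reward collected from step `h` on when `s_h = s`, `a_h = a`, and
`π` is followed after step `h`. -/
noncomputable def Q (M : MDP S A H) (π : Policy S A H) (h : Fin H) (s : S) (a : A) : ℝ :=
  expectedReturn (prependStep M h (rollout M π (H - (h + 1)) (h + 1) (by omega)) s a)

/-- `μ`-recoverability: one deviation from the expert costs at most `μ` in expected return. -/
def Recoverable (M : MDP S A H) (πE : Policy S A H) (μ : ℝ) : Prop :=
  ∀ (h : Fin H) (s : S) (a : A), V M πE h s - Q M πE h s a ≤ μ

/-- Normalized return: the return of every trajectory (under every policy, with probability one)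
is in `[0, R]`. -/
def NormalizedReturn (M : MDP S A H) (R : ℝ) : Prop :=
  ∀ π : Policy S A H, ∀ᵐ τ ∂(trajLaw M π), totalReward τ ∈ Set.Icc 0 R

/-- `d^π`, with the step recorded: the law of `(h, s_h)` where `h` is uniform on the `H` steps and
`(s_1, …, s_H)` comes from running `π`. -/
noncomputable def visitLaw (M : MDP S A H) (π : Policy S A H) : Measure (Fin H × S) :=
  (H : ℝ≥0∞)⁻¹ • ∑ h : Fin H, (trajLaw M π).map fun τ => (h, (τ h).1)

/-- The first-step uniform mixture of `π^1, …, π^N`: one of them is drawn uniformly at random and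
run for the whole episode. This is its law of trajectories. -/
noncomputable def firstStepMixtureLaw (M : MDP S A H) {N : ℕ} (π : Fin N → Policy S A H) :
    Measure (Traj S A H) :=
  (N : ℝ≥0∞)⁻¹ • ∑ n : Fin N, trajLaw M (π n)

open Classical in
/-- The each-step completion of `B`: the policies `(π_1, …, π_H)` with `π_h ∈ B_h` for every `h`,
where `B_h` is the set of the step-`h` components of the policies in `B`. -/
noncomputable def eachStepCompletion (B : Finset (Policy S A H)) : Finset (Policy S A H) :=
  Fintype.piFinset fun h => B.image fun π => π h

/-- An offline data set: `N` reward-free trajectories. -/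
abbrev Dataset (S A : Type*) (H N : ℕ) : Type _ := Fin N → Fin H → S × A

/-- An annotated state: a step, a state, and the action of the expert there. -/
abbrev Obs (S A : Type*) (H : ℕ) : Type _ := Fin H × S × A

open Classical in
/-- `B_bc`: the policies in `B` that satisfy `π_h(s_h) = a_h` (i.e. `π_h(· | s_h)` is the point mass
at `a_h`) for all state-action pairs of the data set. -/
noncomputable def bcClass {N : ℕ} (B : Finset (Policy S A H)) (d : Dataset S A H N) :
    Finset (Policy S A H) :=
  B.filter fun π => ∀ i h, (π h).1 (d i h).1 = Measure.dirac (d i h).2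

/-- The log loss `log (1 / π_h(a | s)) ∈ [0, ∞]`. -/
noncomputable def logLoss (π : Policy S A H) (o : Obs S A H) : EReal :=
  ENNReal.log ((π o.1).1 o.2.1 {o.2.2})⁻¹

/-- The weight of `π` in exponential weights with learning rate `1`: the exponential of minus the
cumulative log loss of `π`. -/
noncomputable def expWeight {n : ℕ} (π : Policy S A H) (obs : Fin n → Obs S A H) : ℝ≥0∞ :=
  EReal.exp (-∑ i, logLoss π (obs i))

theorem measurable_mixture (C : Finset (Policy S A H)) (u : Policy S A H → ℝ≥0∞) (h : Fin H) :
    Measurable fun s => ∑ π ∈ C, u π • (π h).1 s := by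
  refine Measure.measurable_of_measurable_coe _ fun t ht => ?_
  simp only [Measure.coe_finsetSum, Finset.sum_apply, Measure.smul_apply, smul_eq_mul]
  exact Finset.measurable_sum _ fun π _ => ((π h).1.measurable_coe ht).const_mul _

open Classical in
/-- The each-step mixing policy `π̄_u(a | s) = ∑_{π ∈ C} u(π) π(a | s)` of a probability vector `u`
on `C`. (If `u` is not a probability vector, some fixed policy.) -/
noncomputable def eachStepMixture [Nonempty A] (C : Finset (Policy S A H))
    (u : Policy S A H → ℝ≥0∞) : Policy S A H :=
  if hu : ∑ π ∈ C, u π = 1 then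
    fun h => ⟨⟨fun s => ∑ π ∈ C, u π • (π h).1 s, measurable_mixture C u h⟩,
      ⟨fun s => ⟨by simpa using hu⟩⟩⟩
  else Classical.arbitrary _

/-- The policy that Warm-Stagger plays after it has seen the offline data set `d` and the annotated
states `obs`: the each-step mixture of the class `B_bc` under exponential weights. (The weights
can only fail to be normalizable on the null event that the data are inconsistent with all of the
class.) -/
noncomputable def warmStaggerPolicy [Nonempty A] {N n : ℕ} (B : Finset (Policy S A H))
    (d : Dataset S A H N) (obs : Fin n → Obs S A H) : Policy S A H :=
  eachStepMixture (bcClass B d) fun π =>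
    expWeight π obs / ∑ π' ∈ bcClass B d, expWeight π' obs

/-- The law of the offline data set: `N` i.i.d. reward-free trajectories of `πE`. -/
noncomputable def offlineLaw (M : MDP S A H) (πE : Policy S A H) (N : ℕ) :
    Measure (Dataset S A H N) :=
  Measure.pi fun _ => (trajLaw M πE).map fun τ h => ((τ h).1, (τ h).2.1)

/-- The joint law of the offline data set and of the first `n` annotated states in a run of
Warm-Stagger with policy class `B` and deterministic expert `e`: in each round the current policy
is run, a state is sampled from its visitation distribution, and the expert annotates it. -/
noncomputable def interactionLaw [Nonempty A] (M : MDP S A H) (B : Finset (Policy S A H))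
    (e : Fin H → S → A) (he : ∀ h, Measurable (e h)) (N : ℕ) :
    (n : ℕ) → Measure (Dataset S A H N × (Fin n → Obs S A H))
  | 0 => (offlineLaw M (deterministicPolicy e he) N).map fun d => (d, fun i => i.elim0)
  | n + 1 =>
      (interactionLaw M B e he N n).bind fun ω =>
        (visitLaw M (warmStaggerPolicy B ω.1 ω.2)).map fun x =>
          (ω.1, (Fin.snoc ω.2 (x.1, x.2, e x.1 x.2) : Fin (n + 1) → Obs S A H))

/-- The law of trajectories of the output `π̂` of Warm-Stagger after `N'` rounds: the first-step
uniform mixture of `π^1, …, π^{N'}`, where `π^{n+1}` is the policy computed from the data set and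
from the first `n` annotated states. -/
noncomputable def warmStaggerOutput [Nonempty A] {N N' : ℕ} (M : MDP S A H)
    (B : Finset (Policy S A H)) (d : Dataset S A H N) (obs : Fin N' → Obs S A H) :
    Measure (Traj S A H) :=
  firstStepMixtureLaw M fun n : Fin N' =>
    warmStaggerPolicy B d fun i : Fin n => obs (i.castLE n.isLt.le)

end Definitions


section WellDefined

theorem measurable_bind_param {Θ X Y : Type*} [MeasurableSpace Θ] [MeasurableSpace X]
    [MeasurableSpace Y] {κ : Θ → Measure X} (hκ : Measurable κ)
    (hp : ∀ θ, IsProbabilityMeasure (κ θ)) {F : Θ → X → Measure Y}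
    (hF : Measurable fun p : Θ × X => F p.1 p.2) :
    Measurable fun θ => (κ θ).bind (F θ) := by
  let K : Kernel Θ X := ⟨κ, hκ⟩
  have : IsMarkovKernel K := ⟨hp⟩
  refine Measure.measurable_of_measurable_coe _ fun t ht => ?_
  have h1 : ∀ θ, Measurable (F θ) := fun θ => hF.comp measurable_prodMk_left
  simp_rw [fun θ => Measure.bind_apply (m := κ θ) ht (h1 θ).aemeasurable]
  exact Measurable.lintegral_kernel_prod_right' (κ := K) ((Measure.measurable_coe ht).comp hF)

theorem measurable_map_param {Θ X Y : Type*} [MeasurableSpace Θ] [MeasurableSpace X]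
    [MeasurableSpace Y] {κ : Θ → Measure X} (hκ : Measurable κ)
    (hp : ∀ θ, IsProbabilityMeasure (κ θ)) {f : Θ → X → Y}
    (hf : Measurable fun p : Θ × X => f p.1 p.2) :
    Measurable fun θ => (κ θ).map (f θ) := by
  have h1 : ∀ θ, Measurable (f θ) := fun θ => hf.comp measurable_prodMk_left
  simp_rw [fun θ => (Measure.bind_dirac_eq_map (κ θ) (h1 θ)).symm]
  exact measurable_bind_param hκ hp (F := fun θ x => Measure.dirac (f θ x))
    (Measure.measurable_dirac.comp hf)

theorem isProbabilityMeasure_bind_of_measurable {X Y : Type*} [MeasurableSpace X]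
    [MeasurableSpace Y] {m : Measure X} [IsProbabilityMeasure m] {f : X → Measure Y}
    (hf : Measurable f) (hp : ∀ x, IsProbabilityMeasure (f x)) :
    IsProbabilityMeasure (m.bind f) :=
  ⟨by rw [Measure.bind_apply MeasurableSet.univ hf.aemeasurable]; simp⟩

variable {S A : Type*} [MeasurableSpace S] [MeasurableSpace A] {H : ℕ}

theorem measurable_finCons {X : Type*} [MeasurableSpace X] {k : ℕ} :
    Measurable fun p : X × (Fin k → X) => (Fin.cons p.1 p.2 : Fin (k + 1) → X) := by
  refine measurable_pi_lambda _ fun i => ?_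
  refine Fin.cases ?_ (fun j => ?_) i
  · simp only [Fin.cons_zero]
    exact measurable_fst
  · simp only [Fin.cons_succ]
    exact (measurable_pi_apply j).comp measurable_snd

theorem measurable_finSnoc {X : Type*} [MeasurableSpace X] {k : ℕ} :
    Measurable fun p : (Fin k → X) × X => (Fin.snoc p.1 p.2 : Fin (k + 1) → X) := by
  refine measurable_pi_lambda _ fun i => ?_
  refine Fin.lastCases ?_ (fun j => ?_) i
  · simp only [Fin.snoc_last]
    exact measurable_snd
  · simp only [Fin.snoc_castSucc]
    exact (measurable_pi_apply j).comp measurable_fst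

theorem prependStep_wf (M : MDP S A H) (h : Fin H) {k : ℕ} {Θ : Type*} [MeasurableSpace Θ]
    {T : Θ → S → Measure (Traj S A k)} (hT : Measurable fun p : Θ × S => T p.1 p.2)
    (hp : ∀ θ s, IsProbabilityMeasure (T θ s)) :
    (Measurable fun p : Θ × S × A => prependStep M h (T p.1) p.2.1 p.2.2) ∧
      ∀ θ s a, IsProbabilityMeasure (prependStep M h (T θ) s a) := by
  have c1 : Measurable fun p : (((Θ × S × A) × unitInterval) × S) × Traj S A k =>
      (Fin.cons (p.1.1.1.2.1, p.1.1.1.2.2, p.1.1.2) p.2 : Traj S A (k + 1)) := by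
    have : Measurable fun p : (((Θ × S × A) × unitInterval) × S) × Traj S A k =>
        (((p.1.1.1.2.1, p.1.1.1.2.2, p.1.1.2) : S × A × unitInterval), p.2) := by fun_prop
    exact measurable_finCons.comp this
  have t1 : Measurable fun q : ((Θ × S × A) × unitInterval) × S => T q.1.1.1 q.2 := by
    have : Measurable fun q : ((Θ × S × A) × unitInterval) × S => (q.1.1.1, q.2) := by fun_prop
    exact hT.comp this
  have m1 := measurable_map_param t1 (fun q => hp q.1.1.1 q.2)
    (f := fun q τ => (Fin.cons (q.1.1.2.1, q.1.1.2.2, q.1.2) τ : Traj S A (k + 1))) c1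
  have t2 : Measurable fun q : (Θ × S × A) × unitInterval => M.trans h (q.1.2.1, q.1.2.2) := by
    have : Measurable fun q : (Θ × S × A) × unitInterval => (q.1.2.1, q.1.2.2) := by fun_prop
    exact (M.trans h).measurable.comp this
  have m2 := measurable_bind_param t2 (fun _ => inferInstance)
    (F := fun q s' => (T q.1.1 s').map fun τ =>
      (Fin.cons (q.1.2.1, q.1.2.2, q.2) τ : Traj S A (k + 1))) m1
  have t3 : Measurable fun q : Θ × S × A => M.reward (q.2.1, q.2.2) :=
    M.reward.measurable.comp measurable_snd
  have m3 := measurable_bind_param t3 (fun _ => inferInstance)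
    (F := fun q r => (M.trans h (q.2.1, q.2.2)).bind fun s' => (T q.1 s').map fun τ =>
      (Fin.cons (q.2.1, q.2.2, r) τ : Traj S A (k + 1))) m2
  refine ⟨m3, fun θ s a => ?_⟩
  have n2 : Measurable fun r : unitInterval => (M.trans h (s, a)).bind fun s' =>
      (T θ s').map fun τ => (Fin.cons (s, a, r) τ : Traj S A (k + 1)) := by
    have : Measurable fun r : unitInterval => (((θ, s, a) : Θ × S × A), r) := by fun_prop
    simpa only [Function.comp_def] using m2.comp this
  have n1 : ∀ r : unitInterval, Measurable fun s' : S =>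
      (T θ s').map fun τ => (Fin.cons (s, a, r) τ : Traj S A (k + 1)) := fun r => by
    have : Measurable fun s' : S => ((((θ, s, a), r) : (Θ × S × A) × unitInterval), s') := by
      fun_prop
    simpa only [Function.comp_def] using m1.comp this
  have n0 : ∀ r : unitInterval, Measurable fun τ : Traj S A k =>
      (Fin.cons (s, a, r) τ : Traj S A (k + 1)) := fun r => by
    have : Measurable fun τ : Traj S A k => (((s, a, r) : S × A × unitInterval), τ) := by
      fun_prop
    exact measurable_finCons.comp this
  exact isProbabilityMeasure_bind_of_measurable n2 fun r =>
    isProbabilityMeasure_bind_of_measurable (n1 r) fun s' =>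
      have := hp θ s'
      Measure.isProbabilityMeasure_map (n0 r).aemeasurable

theorem rollout_succ (M : MDP S A H) (π : Policy S A H) (k h : ℕ) (hk : h + (k + 1) ≤ H) (s : S) :
    rollout M π (k + 1) h hk s = ((π ⟨h, by omega⟩).1 s).bind fun a =>
      prependStep M ⟨h, by omega⟩ (rollout M π k (h + 1) (by omega)) s a := by
  rw [rollout]

theorem rollout_wf (M : MDP S A H) {Θ : Type*} [MeasurableSpace Θ] {π : Θ → Policy S A H}
    (hπ : ∀ h, Measurable fun p : Θ × S => (π p.1 h).1 p.2) (k h : ℕ) (hk : h + k ≤ H) :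
    (Measurable fun p : Θ × S => rollout M (π p.1) k h hk p.2) ∧
      ∀ θ s, IsProbabilityMeasure (rollout M (π θ) k h hk s) := by
  induction k generalizing h with
  | zero => exact ⟨measurable_const, fun θ s => Measure.dirac.isProbabilityMeasure⟩
  | succ k ih =>
    obtain ⟨i1, i2⟩ := ih (h + 1) (by omega)
    obtain ⟨p1, p2⟩ := prependStep_wf M ⟨h, by omega⟩
      (T := fun θ s => rollout M (π θ) k (h + 1) (by omega) s) i1 i2
    have p1' : Measurable fun q : (Θ × S) × A =>
        prependStep M ⟨h, by omega⟩ (rollout M (π q.1.1) k (h + 1) (by omega)) q.1.2 q.2 := by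
      have : Measurable fun q : (Θ × S) × A => (q.1.1, q.1.2, q.2) := by fun_prop
      simpa only [Function.comp_def] using p1.comp this
    simp only [rollout_succ]
    refine ⟨measurable_bind_param (κ := fun p : Θ × S => (π p.1 ⟨h, by omega⟩).1 p.2)
      (hπ ⟨h, by omega⟩) (fun _ => inferInstance)
      (F := fun q a => prependStep M ⟨h, by omega⟩
        (rollout M (π q.1) k (h + 1) (by omega)) q.2 a) p1', fun θ s => ?_⟩
    have n1 : Measurable fun a : A =>
        prependStep M ⟨h, by omega⟩ (rollout M (π θ) k (h + 1) (by omega)) s a := by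
      have : Measurable fun a : A => (((θ, s) : Θ × S), a) := by fun_prop
      simpa only [Function.comp_def] using p1'.comp this
    exact isProbabilityMeasure_bind_of_measurable n1 fun a => p2 θ s a

theorem trajLaw_wf (M : MDP S A H) {Θ : Type*} [MeasurableSpace Θ] {π : Θ → Policy S A H}
    (hπ : ∀ h, Measurable fun p : Θ × S => (π p.1 h).1 p.2) :
    (Measurable fun θ => trajLaw M (π θ)) ∧ ∀ θ, IsProbabilityMeasure (trajLaw M (π θ)) := by
  obtain ⟨r1, r2⟩ := rollout_wf M hπ H 0 (by omega)
  exact ⟨measurable_bind_param measurable_const (fun _ => inferInstance) r1,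
    fun θ => isProbabilityMeasure_bind_of_measurable
      (r1.comp (measurable_prodMk_left (x := θ))) (r2 θ)⟩

instance isProbabilityMeasure_trajLaw (M : MDP S A H) (π : Policy S A H) :
    IsProbabilityMeasure (trajLaw M π) :=
  (trajLaw_wf M (Θ := Unit) (π := fun _ => π)
    fun h => (π h).1.measurable.comp measurable_snd).2 ()

theorem visitLaw_wf [NeZero H] (M : MDP S A H) {Θ : Type*} [MeasurableSpace Θ]
    {π : Θ → Policy S A H} (hπ : ∀ h, Measurable fun p : Θ × S => (π p.1 h).1 p.2) :
    (Measurable fun θ => visitLaw M (π θ)) ∧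
      ∀ θ, IsProbabilityMeasure (visitLaw M (π θ)) := by
  have hm : ∀ h : Fin H, Measurable fun τ : Traj S A H => (h, (τ h).1) := fun h => by fun_prop
  refine ⟨?_, fun θ => ⟨?_⟩⟩
  · refine Measure.measurable_of_measurable_coe _ fun t ht => ?_
    simp only [visitLaw, Measure.smul_apply, Measure.coe_finsetSum, Finset.sum_apply, smul_eq_mul]
    refine (Finset.measurable_sum _ fun h _ => ?_).const_mul _
    simp_rw [fun θ => Measure.map_apply (μ := trajLaw M (π θ)) (hm h) ht]
    exact (Measure.measurable_coe (hm h ht)).comp (trajLaw_wf M hπ).1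
  · simp only [visitLaw, Measure.smul_apply, Measure.coe_finsetSum, Finset.sum_apply, smul_eq_mul]
    simp_rw [fun h => Measure.map_apply (μ := trajLaw M (π θ)) (hm h) MeasurableSet.univ]
    have : (H : ℝ≥0∞) ≠ 0 := by exact_mod_cast NeZero.ne H
    simp [ENNReal.inv_mul_cancel this (ENNReal.natCast_ne_top H)]

theorem measurable_expWeight [MeasurableEq A] {n : ℕ} (π : Policy S A H) :
    Measurable fun obs : Fin n → Obs S A H => expWeight π obs := by
  have hl : ∀ h : Fin H, Measurable fun x : S × A => (π h).1 x.1 {x.2} := fun h => by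
    have ht : MeasurableSet {p : (S × A) × A | p.2 = p.1.2} :=
      measurableSet_eq_fun measurable_snd measurable_fst.snd
    exact Kernel.measurable_kernel_prodMk_left
      (κ := (π h).1.comap (Prod.fst : S × A → S) measurable_fst) ht
  have hl' : Measurable fun o : Obs S A H => (π o.1).1 o.2.1 {o.2.2} :=
    measurable_from_prod_countable_right fun h => hl h
  have key : ∀ obs : Fin n → Obs S A H,
      expWeight π obs = ∏ i, (π (obs i).1).1 (obs i).2.1 {(obs i).2.2} := by
    intro obs
    have gen : ∀ s : Finset (Fin n), (-∑ i ∈ s, logLoss π (obs i)) =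
        ENNReal.log (∏ i ∈ s, (π (obs i).1).1 (obs i).2.1 {(obs i).2.2}) := by
      intro s
      have h2 : ∑ i ∈ s, logLoss π (obs i) =
          ENNReal.log (∏ i ∈ s, ((π (obs i).1).1 (obs i).2.1 {(obs i).2.2})⁻¹) := by
        induction s using Finset.induction_on with
        | empty => simp
        | insert a s ha ih =>
          rw [Finset.sum_insert ha, Finset.prod_insert ha, ENNReal.log_mul_add, ih, logLoss]
      rw [h2, ← ENNReal.log_inv]
      congr 1
      rw [← ENNReal.prod_inv_distrib, inv_inv]
      intro i _ j _ _
      exact Or.inr (measure_ne_top _ _)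
    rw [expWeight, gen, ENNReal.exp_log]
  simp_rw [key]
  exact Finset.measurable_prod _ fun i _ => hl'.comp (measurable_pi_apply i)

theorem measurable_warmStaggerPolicy [Nonempty A] [MeasurableEq A] {N n : ℕ}
    (B : Finset (Policy S A H)) (h : Fin H) :
    Measurable fun p : (Dataset S A H N × (Fin n → Obs S A H)) × S =>
      (warmStaggerPolicy B p.1.1 p.1.2 h).1 p.2 := by
  classical
  have hset : ∀ π : Policy S A H, MeasurableSet {d : Dataset S A H N |
      ∀ i h, (π h).1 (d i h).1 = Measure.dirac (d i h).2} := by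
    intro π
    have he : {d : Dataset S A H N | ∀ i h, (π h).1 (d i h).1 = Measure.dirac (d i h).2} =
        ⋂ i, ⋂ h, {d | (π h).1 (d i h).1 {(d i h).2} = 1} := by
      ext d
      simp only [Set.mem_ofPred_eq, Set.mem_iInter]
      refine forall_congr' fun i => forall_congr' fun h => ⟨fun hd => by simp [hd], fun hd => ?_⟩
      have hae : ∀ᵐ a ∂((π h).1 (d i h).1), a = (d i h).2 := by
        have := (prob_compl_eq_zero_iff (μ := (π h).1 (d i h).1)
          (measurableSet_singleton (d i h).2)).2 hd
        rw [ae_iff]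
        exact this
      have hmap : ((π h).1 (d i h).1).map id = ((π h).1 (d i h).1).map fun _ => (d i h).2 :=
        Measure.map_congr hae
      simpa using hmap
    rw [he]
    refine MeasurableSet.iInter fun i => MeasurableSet.iInter fun h => ?_
    have hl : Measurable fun x : S × A => (π h).1 x.1 {x.2} := by
      have ht : MeasurableSet {p : (S × A) × A | p.2 = p.1.2} :=
        measurableSet_eq_fun measurable_snd measurable_fst.snd
      exact Kernel.measurable_kernel_prodMk_left
        (κ := (π h).1.comap (Prod.fst : S × A → S) measurable_fst) ht
    exact (hl.comp (by fun_prop : Measurable fun d : Dataset S A H N => d i h))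
      (measurableSet_singleton 1)
  have hu : ∀ g : Policy S A H → (Dataset S A H N × (Fin n → Obs S A H)) × S → ℝ≥0∞,
      (∀ π, Measurable (g π)) → Measurable fun p => ∑ π ∈ bcClass B p.1.1, g π p := by
    intro g hg
    simp only [bcClass, Finset.sum_filter]
    refine Finset.measurable_sum _ fun π _ => Measurable.ite ?_ (hg π) measurable_const
    exact (hset π).preimage measurable_fst.fst
  have hw : ∀ π : Policy S A H, Measurable
      fun p : (Dataset S A H N × (Fin n → Obs S A H)) × S => expWeight π p.1.2 :=
    fun π => (measurable_expWeight π).comp measurable_fst.snd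
  have hv : ∀ π : Policy S A H, Measurable
      fun p : (Dataset S A H N × (Fin n → Obs S A H)) × S =>
        expWeight π p.1.2 / ∑ π' ∈ bcClass B p.1.1, expWeight π' p.1.2 :=
    fun π => (hw π).div (hu _ hw)
  have e1 : (fun p : (Dataset S A H N × (Fin n → Obs S A H)) × S =>
      (warmStaggerPolicy B p.1.1 p.1.2 h).1 p.2) = fun p =>
      if ∑ π ∈ bcClass B p.1.1,
          expWeight π p.1.2 / ∑ π' ∈ bcClass B p.1.1, expWeight π' p.1.2 = 1 then
        ∑ π ∈ bcClass B p.1.1,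
          (expWeight π p.1.2 / ∑ π' ∈ bcClass B p.1.1, expWeight π' p.1.2) • (π h).1 p.2
      else ((Classical.arbitrary (Policy S A H)) h).1 p.2 := by
    funext p
    unfold warmStaggerPolicy eachStepMixture
    split_ifs <;> rfl
  rw [e1]
  refine Measurable.ite (hu _ hv (measurableSet_singleton 1)) ?_
    ((Kernel.measurable _).comp measurable_snd)
  refine Measure.measurable_of_measurable_coe _ fun t ht => ?_
  simp only [Measure.coe_finsetSum, Finset.sum_apply, Measure.smul_apply, smul_eq_mul]
  exact hu _ fun π => (hv π).mul (((π h).1.measurable_coe ht).comp measurable_snd)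

/-- The law of the interaction is a probability measure: no `bind` in it is degenerate. -/
theorem isProbabilityMeasure_interactionLaw [Nonempty A] [MeasurableEq A] [NeZero H]
    (M : MDP S A H) (B : Finset (Policy S A H)) (e : Fin H → S → A)
    (he : ∀ h, Measurable (e h)) (N n : ℕ) :
    IsProbabilityMeasure (interactionLaw M B e he N n) := by
  induction n with
  | zero =>
    have : IsProbabilityMeasure ((trajLaw M (deterministicPolicy e he)).map
        fun τ h => ((τ h).1, (τ h).2.1)) :=
      Measure.isProbabilityMeasure_map (by fun_prop)
    have : IsProbabilityMeasure (offlineLaw M (deterministicPolicy e he) N) := by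
      unfold offlineLaw; infer_instance
    exact Measure.isProbabilityMeasure_map (by fun_prop)
  | succ n ih =>
    obtain ⟨v1, v2⟩ := visitLaw_wf M
      (π := fun ω : Dataset S A H N × (Fin n → Obs S A H) => warmStaggerPolicy B ω.1 ω.2)
      (measurable_warmStaggerPolicy B)
    have hE : Measurable fun x : Fin H × S => e x.1 x.2 :=
      measurable_from_prod_countable_right fun h => he h
    have hf : Measurable fun p : (Dataset S A H N × (Fin n → Obs S A H)) × (Fin H × S) =>
        (p.1.1, (Fin.snoc p.1.2 (p.2.1, p.2.2, e p.2.1 p.2.2) : Fin (n + 1) → Obs S A H)) := by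
      refine measurable_fst.fst.prodMk (measurable_finSnoc.comp (measurable_fst.snd.prodMk ?_))
      exact measurable_snd.fst.prodMk (measurable_snd.snd.prodMk (hE.comp measurable_snd))
    refine isProbabilityMeasure_bind_of_measurable (measurable_map_param v1 v2 hf) fun ω => ?_
    have := v2 ω
    exact Measure.isProbabilityMeasure_map (hf.comp measurable_prodMk_left).aemeasurable

end WellDefined

end HybridIL

set_option linter.unusedSectionVars false

/-! The two terms of the minimum are bounded separately, each outside an event of probability `δ /
2`.

Offline term. The law of trajectories of a policy dominates the expert's law weighted by the product
over `h` of the probabilities of the expert's action (`lintegral_mul_matchProb_trajLaw_le`). For an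
each-step mixture this product expands, by multilinearity, into a convex combination over tuples of
members of the class; a tuple spliced step by step is a member of the each-step completion, which is
where its size enters. A tuple from `bcClass` is consistent with all offline data, so by a union
bound over the completion (`offlineLaw_undetected_le`) it disagrees with the expert on a set of
trajectories of probability at most `ε`, of order `log (size / δ) / N`. As the return is at most
`R`, the loss of the mixture is at most `R * ε`, whatever the weights
(`lexpectedReturn_deterministic_le_eachStepMixture`).

Interactive term. The performance difference argument and recoverability give a loss of at most `μ *
H * deviation` for each policy played (`lexpectedReturn_rollout_deterministic_le`), so it remains to
bound the cumulative deviation. With learning rate `1`, exponential weights are the Bayes mixture: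
the total weight is multiplied in each round by the probability that the played policy gives to the
annotation (`sum_expWeight_snoc`). The conditional mean of that factor is `1 - deviation ≤ exp
(-deviation)`, so the normalized total weight times `exp` of the cumulative deviation is a
supermartingale started at or below `1` (`lintegral_potential_le_one`). The expert always keeps
weight `1`, so Markov's inequality bounds the cumulative deviation by `log (2 * card / δ)`.

The factor `2` inside the logarithms, due to splitting `δ`, is absorbed into the constant if
`bcClass` has at least two members; if the expert is its only member, there is no loss at all. -/

namespace HybridIL

/-! ### Integration against trajectory laws, and returns as lower integrals -/

section Rollout

variable {S A : Type*} [MeasurableSpace S] [MeasurableSpace A] {H : ℕ}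

theorem measurable_rollout (M : MDP S A H) (π : Policy S A H) (k h : ℕ) (hk : h + k ≤ H) :
    Measurable (rollout M π k h hk) :=
  (rollout_wf M (Θ := Unit) (π := fun _ => π)
    (fun h => (π h).1.measurable.comp measurable_snd) k h hk).1.comp
      (measurable_prodMk_left (x := ()))

instance isProbabilityMeasure_rollout (M : MDP S A H) (π : Policy S A H) (k h : ℕ)
    (hk : h + k ≤ H) (s : S) : IsProbabilityMeasure (rollout M π k h hk s) :=
  (rollout_wf M (Θ := Unit) (π := fun _ => π)
    (fun h => (π h).1.measurable.comp measurable_snd) k h hk).2 () s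

theorem measurable_prependStep (M : MDP S A H) (h : Fin H) {k : ℕ} {T : S → Measure (Traj S A k)}
    (hT : Measurable T) (hp : ∀ s, IsProbabilityMeasure (T s)) (s : S) :
    Measurable fun a => prependStep M h T s a :=
  (prependStep_wf M h (Θ := Unit) (T := fun _ => T) (hT.comp measurable_snd)
    fun _ => hp).1.comp (g := fun p : Unit × S × A => prependStep M h T p.2.1 p.2.2)
      (f := fun a => ((), s, a)) (by fun_prop)

theorem isProbabilityMeasure_prependStep (M : MDP S A H) (h : Fin H) {k : ℕ}
    {T : S → Measure (Traj S A k)} (hT : Measurable T) (hp : ∀ s, IsProbabilityMeasure (T s))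
    (s : S) (a : A) : IsProbabilityMeasure (prependStep M h T s a) :=
  (prependStep_wf M h (Θ := Unit) (T := fun _ => T) (hT.comp measurable_snd)
    fun _ => hp).2 () s a

theorem lintegral_prependStep (M : MDP S A H) (h : Fin H) {k : ℕ} {T : S → Measure (Traj S A k)}
    (hT : Measurable T) (hp : ∀ s, IsProbabilityMeasure (T s)) (s : S) (a : A)
    {f : Traj S A (k + 1) → ℝ≥0∞} (hf : Measurable f) :
    ∫⁻ τ, f τ ∂(prependStep M h T s a) =
      ∫⁻ r, ∫⁻ s', ∫⁻ τ, f (Fin.cons (s, a, r) τ) ∂(T s') ∂(M.trans h (s, a))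
        ∂(M.reward (s, a)) := by
  have c1 : Measurable fun p : (unitInterval × S) × Traj S A k =>
      (Fin.cons (s, a, p.1.1) p.2 : Traj S A (k + 1)) := by
    have : Measurable fun p : (unitInterval × S) × Traj S A k =>
        (((s, a, p.1.1) : S × A × unitInterval), p.2) := by fun_prop
    exact measurable_finCons.comp this
  have c0 : ∀ r : unitInterval, Measurable fun τ : Traj S A k =>
      (Fin.cons (s, a, r) τ : Traj S A (k + 1)) := fun r => by
    have : Measurable fun τ : Traj S A k => (((s, a, r) : S × A × unitInterval), τ) := by
      fun_prop
    exact measurable_finCons.comp this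
  have m1 := measurable_map_param (κ := fun q : unitInterval × S => T q.2)
    (hT.comp measurable_snd) (fun q => hp q.2)
    (f := fun q τ => (Fin.cons (s, a, q.1) τ : Traj S A (k + 1))) c1
  have m2 := measurable_bind_param (κ := fun _ : unitInterval => M.trans h (s, a))
    measurable_const (fun _ => inferInstance)
    (F := fun r s' => (T s').map fun τ => (Fin.cons (s, a, r) τ : Traj S A (k + 1))) m1
  rw [prependStep, Measure.lintegral_bind m2.aemeasurable hf.aemeasurable]
  refine lintegral_congr fun r => ?_
  have n1 : Measurable fun s' : S =>
      (T s').map fun τ => (Fin.cons (s, a, r) τ : Traj S A (k + 1)) :=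
    m1.comp (measurable_prodMk_left (x := r))
  rw [Measure.lintegral_bind n1.aemeasurable hf.aemeasurable]
  exact lintegral_congr fun s' => lintegral_map hf (c0 r)

theorem lintegral_rollout_succ (M : MDP S A H) (π : Policy S A H) (k h : ℕ)
    (hk : h + (k + 1) ≤ H) (s : S) {f : Traj S A (k + 1) → ℝ≥0∞} (hf : Measurable f) :
    ∫⁻ τ, f τ ∂(rollout M π (k + 1) h hk s) =
      ∫⁻ a, ∫⁻ τ, f τ ∂(prependStep M ⟨h, by omega⟩ (rollout M π k (h + 1) (by omega)) s a)
        ∂((π ⟨h, by omega⟩).1 s) := by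
  rw [rollout_succ, Measure.lintegral_bind _ hf.aemeasurable]
  exact (measurable_prependStep M _ (measurable_rollout M π k (h + 1) (by omega))
    inferInstance s).aemeasurable

theorem lintegral_trajLaw (M : MDP S A H) (π : Policy S A H) {f : Traj S A H → ℝ≥0∞}
    (hf : Measurable f) :
    ∫⁻ τ, f τ ∂(trajLaw M π) = ∫⁻ s, ∫⁻ τ, f τ ∂(rollout M π H 0 (by omega) s) ∂M.init := by
  rw [trajLaw, Measure.lintegral_bind (measurable_rollout M π H 0 _).aemeasurable hf.aemeasurable]

theorem measurable_totalReward {n : ℕ} : Measurable (totalReward : Traj S A n → ℝ) := by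
  unfold totalReward; fun_prop

theorem totalReward_nonneg {n : ℕ} (τ : Traj S A n) : 0 ≤ totalReward τ :=
  Finset.sum_nonneg fun i _ => (τ i).2.2.2.1

theorem totalReward_cons {n : ℕ} (x : S × A × unitInterval) (τ : Traj S A n) :
    totalReward (Fin.cons x τ : Traj S A (n + 1)) = x.2.2 + totalReward τ := by
  simp [totalReward, Fin.sum_univ_succ]

theorem totalReward_le {n : ℕ} (τ : Traj S A n) : totalReward τ ≤ n := by
  refine (Finset.sum_le_card_nsmul _ _ 1 fun i _ => (τ i).2.2.2.2).trans ?_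
  simp

/-- The expected total reward, as an extended nonnegative real number. -/
noncomputable def lexpectedReturn {n : ℕ} (P : Measure (Traj S A n)) : ℝ≥0∞ :=
  ∫⁻ τ, ENNReal.ofReal (totalReward τ) ∂P

/-- Rewards are nonnegative, so returns can be compared in `ℝ≥0∞`, where no integrability is needed;
this identity and the finiteness below carry the results back to `ℝ`. -/
theorem expectedReturn_eq_toReal {n : ℕ} (P : Measure (Traj S A n)) :
    expectedReturn P = (lexpectedReturn P).toReal :=
  integral_eq_lintegral_of_nonneg_ae (Filter.Eventually.of_forall totalReward_nonneg)
    measurable_totalReward.aestronglyMeasurable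

theorem lexpectedReturn_ne_top {n : ℕ} (P : Measure (Traj S A n)) [IsFiniteMeasure P] :
    lexpectedReturn P ≠ ∞ := by
  refine ne_top_of_le_ne_top (b := ∫⁻ _, (n : ℝ≥0∞) ∂P) (by simp [ENNReal.mul_eq_top]) ?_
  refine lintegral_mono fun τ => ?_
  simpa using ENNReal.ofReal_le_ofReal (totalReward_le τ)

theorem ofReal_expectedReturn {n : ℕ} (P : Measure (Traj S A n)) [IsFiniteMeasure P] :
    ENNReal.ofReal (expectedReturn P) = lexpectedReturn P := by
  rw [expectedReturn_eq_toReal, ENNReal.ofReal_toReal (lexpectedReturn_ne_top P)]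

theorem measurable_ofReal_totalReward {n : ℕ} :
    Measurable fun τ : Traj S A n => ENNReal.ofReal (totalReward τ) :=
  measurable_totalReward.ennreal_ofReal

/-- The number of remaining steps occurs in the type of the trajectory, so `H - h` in `V` and `Q`
cannot simply be rewritten to the form `k + 1` used in inductions. -/
theorem expectedReturn_rollout_congr (M : MDP S A H) (π : Policy S A H) {k k' h : ℕ}
    (hkk : k = k') (hk : h + k ≤ H) (hk' : h + k' ≤ H) (s : S) :
    expectedReturn (rollout M π k h hk s) = expectedReturn (rollout M π k' h hk' s) := by
  subst hkk; rfl

theorem expectedReturn_prependStep_congr (M : MDP S A H) (π : Policy S A H) (i : Fin H)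
    {k k' h : ℕ} (hkk : k = k') (hk : h + k ≤ H) (hk' : h + k' ≤ H) (s : S) (a : A) :
    expectedReturn (prependStep M i (rollout M π k h hk) s a) =
      expectedReturn (prependStep M i (rollout M π k' h hk') s a) := by
  subst hkk; rfl

end Rollout

/-! ### Comparing a policy with the expert: change of measure and performance difference -/

section Expert

variable {S A : Type*} [MeasurableSpace S] [MeasurableSpace A] [MeasurableEq A] {H : ℕ}

/-- The probability that `π` plays the expert's action in state `s` at step `h`. -/
noncomputable def matchProb (e : Fin H → S → A) (π : Policy S A H) (h : Fin H) (s : S) : ℝ≥0∞ :=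
  (π h).1 s {e h s}

theorem matchProb_le_one (e : Fin H → S → A) (π : Policy S A H) (h : Fin H) (s : S) :
    matchProb e π h s ≤ 1 := prob_le_one

theorem measurable_matchProb_param {Θ : Type*} [MeasurableSpace Θ] {e : Fin H → S → A}
    (he : ∀ h, Measurable (e h)) {π : Θ → Policy S A H}
    (h : Fin H) (hπ : Measurable fun p : Θ × S => (π p.1 h).1 p.2) :
    Measurable fun p : Θ × S => matchProb e (π p.1) h p.2 := by
  let K : Kernel (Θ × S) A := ⟨_, hπ⟩
  have : IsMarkovKernel K := ⟨fun p => (π p.1 h).2.1 p.2⟩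
  have ht : MeasurableSet {p : (Θ × S) × A | p.2 = e h p.1.2} :=
    measurableSet_eq_fun measurable_snd ((he h).comp measurable_fst.snd)
  exact Kernel.measurable_kernel_prodMk_left (κ := K) ht

theorem measurable_matchProb {e : Fin H → S → A} (he : ∀ h, Measurable (e h))
    (π : Policy S A H) (h : Fin H) : Measurable (matchProb e π h) :=
  (measurable_matchProb_param (Θ := Unit) he (π := fun _ => π) h
    ((π h).1.measurable.comp measurable_snd)).comp (measurable_prodMk_left (x := ()))

theorem lintegral_rollout_deterministic_succ (M : MDP S A H) {e : Fin H → S → A}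
    (he : ∀ h, Measurable (e h)) (k h : ℕ)
    (hk : h + (k + 1) ≤ H) (s : S) {f : Traj S A (k + 1) → ℝ≥0∞} (hf : Measurable f) :
    ∫⁻ τ, f τ ∂(rollout M (deterministicPolicy e he) (k + 1) h hk s) =
      ∫⁻ τ, f τ ∂(prependStep M ⟨h, by omega⟩
        (rollout M (deterministicPolicy e he) k (h + 1) (by omega)) s (e ⟨h, by omega⟩ s)) := by
  rw [lintegral_rollout_succ _ _ _ _ _ _ hf]
  simp only [deterministicPolicy, Kernel.deterministic_apply]
  rw [lintegral_dirac]

/-- At each step the action kernel of `π` dominates its atom at the expert's action. Keeping only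
these atoms leaves the expert's rollout, weighted by the product of their masses. -/
theorem lintegral_mul_matchProb_rollout_le (M : MDP S A H) {e : Fin H → S → A}
    (he : ∀ h, Measurable (e h)) (π : Policy S A H) (k h : ℕ) (hk : h + k ≤ H) (s : S)
    {f : Traj S A k → ℝ≥0∞} (hf : Measurable f) :
    ∫⁻ τ, f τ * ∏ i : Fin k, matchProb e π ⟨h + i, by omega⟩ (τ i).1
        ∂(rollout M (deterministicPolicy e he) k h hk s)
      ≤ ∫⁻ τ, f τ ∂(rollout M π k h hk s) := by
  induction k generalizing h s with
  | zero => simp [rollout]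
  | succ k ih =>
    have mm : ∀ (k h : ℕ) (hk : h + k ≤ H), Measurable fun τ : Traj S A k =>
        ∏ i : Fin k, matchProb e π ⟨h + i, by omega⟩ (τ i).1 := fun k h hk =>
      Finset.measurable_prod _ fun i _ => (measurable_matchProb he π _).comp (by fun_prop)
    have c0 : ∀ (a : A) (r : unitInterval), Measurable fun τ : Traj S A k =>
        (Fin.cons (s, a, r) τ : Traj S A (k + 1)) := fun a r => by
      have : Measurable fun τ : Traj S A k => (((s, a, r) : S × A × unitInterval), τ) := by
        fun_prop
      exact measurable_finCons.comp this
    set a₀ := e ⟨h, by omega⟩ s with ha₀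
    have hfm : Measurable fun τ : Traj S A (k + 1) =>
        f τ * ∏ i : Fin (k + 1), matchProb e π ⟨h + i, by omega⟩ (τ i).1 :=
      hf.mul (mm (k + 1) h hk)
    rw [lintegral_rollout_deterministic_succ _ _ _ _ _ _ hfm,
      lintegral_rollout_succ _ _ _ _ _ _ hf,
      lintegral_prependStep _ _ (measurable_rollout _ _ _ _ _) inferInstance _ _ hfm]
    have fin : matchProb e π ⟨h, by omega⟩ s ≠ ∞ := measure_ne_top _ _
    have step : ∀ r s', ∫⁻ τ, f (Fin.cons (s, a₀, r) τ) * ∏ i : Fin (k + 1),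
          matchProb e π ⟨h + i, by omega⟩ ((Fin.cons (s, a₀, r) τ : Traj S A (k + 1)) i).1
          ∂(rollout M (deterministicPolicy e he) k (h + 1) (by omega) s')
        ≤ matchProb e π ⟨h, by omega⟩ s *
          ∫⁻ τ, f (Fin.cons (s, a₀, r) τ) ∂(rollout M π k (h + 1) (by omega) s') := by
      intro r s'
      refine le_trans (le_of_eq ?_)
        (mul_le_mul_right (ih (h + 1) (by omega) s' (hf.comp (c0 a₀ r))) _)
      rw [← lintegral_const_mul' _ _ fin]
      refine lintegral_congr fun τ => ?_
      rw [Fin.prod_univ_succ]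
      simp only [Fin.cons_zero, Fin.cons_succ, Fin.val_zero, Fin.val_succ, add_zero,
        Function.comp_apply]
      -- Entry `i + 1` of the trajectory from step `h` is entry `i` of its tail, which starts at
      -- step `h + 1`.
      have : ∀ i : Fin k, (⟨h + (i + 1), by omega⟩ : Fin H) = ⟨h + 1 + i, by omega⟩ :=
        fun i => by ext; simp; omega
      simp only [this]
      ring
    refine (lintegral_mono fun r => lintegral_mono fun s' => step r s').trans ?_
    simp_rw [lintegral_const_mul' _ _ fin]
    rw [← lintegral_prependStep _ _ (measurable_rollout _ _ _ _ _) inferInstance _ _ hf, mul_comm]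
    -- All actions of `π` other than the expert's are discarded here.
    refine le_trans (le_of_eq ?_) (setLIntegral_le_lintegral {a₀} _)
    rw [lintegral_singleton]
    rfl

theorem lintegral_mul_matchProb_trajLaw_le (M : MDP S A H) {e : Fin H → S → A}
    (he : ∀ h, Measurable (e h)) (π : Policy S A H) {f : Traj S A H → ℝ≥0∞} (hf : Measurable f) :
    ∫⁻ τ, f τ * ∏ h, matchProb e π h (τ h).1 ∂(trajLaw M (deterministicPolicy e he))
      ≤ ∫⁻ τ, f τ ∂(trajLaw M π) := by
  have mm : Measurable fun τ : Traj S A H => ∏ h, matchProb e π h (τ h).1 :=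
    Finset.measurable_prod _ fun i _ => (measurable_matchProb he π _).comp (by fun_prop)
  have hfm : Measurable fun τ : Traj S A H => f τ * ∏ h, matchProb e π h (τ h).1 := hf.mul mm
  rw [lintegral_trajLaw _ _ hf, lintegral_trajLaw _ _ hfm]
  refine lintegral_mono fun s => ?_
  simpa using lintegral_mul_matchProb_rollout_le M he π H 0 (by omega) s hf

theorem ae_rollout_action_eq (M : MDP S A H) {e : Fin H → S → A}
    (he : ∀ h, Measurable (e h)) (k h : ℕ) (hk : h + k ≤ H) (s : S) :
    ∀ᵐ τ ∂(rollout M (deterministicPolicy e he) k h hk s),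
      ∀ i : Fin k, (τ i).2.1 = e ⟨h + i, by omega⟩ (τ i).1 := by
  have ms : ∀ (k h : ℕ) (hk : h + k ≤ H), MeasurableSet {τ : Traj S A k |
      ∀ i : Fin k, (τ i).2.1 = e ⟨h + i, by omega⟩ (τ i).1} := fun k h hk => by
    rw [Set.ofPred_forall]
    exact MeasurableSet.iInter fun i =>
      measurableSet_eq_fun (by fun_prop) ((he _).comp (by fun_prop))
  induction k generalizing h s with
  | zero => exact Filter.Eventually.of_forall fun τ i => i.elim0
  | succ k ih =>
    have hm := (ms (k + 1) h hk).compl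
    have key : ∫⁻ τ, Set.indicator {τ : Traj S A (k + 1) |
        ∀ i : Fin (k + 1), (τ i).2.1 = e ⟨h + i, by omega⟩ (τ i).1}ᶜ (1 : Traj S A (k + 1) → ℝ≥0∞) τ
        ∂(rollout M (deterministicPolicy e he) (k + 1) h hk s) = 0 := by
      have mi := (measurable_one (α := ℝ≥0∞)).indicator hm
      rw [lintegral_rollout_deterministic_succ _ _ _ _ _ _ mi,
        lintegral_prependStep _ _ (measurable_rollout _ _ _ _ _) inferInstance _ _ mi]
      have z : ∀ r s', ∫⁻ τ, Set.indicator {τ : Traj S A (k + 1) |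
          ∀ i : Fin (k + 1), (τ i).2.1 = e ⟨h + i, by omega⟩ (τ i).1}ᶜ (1 : Traj S A (k + 1) → ℝ≥0∞)
            (Fin.cons (s, e ⟨h, by omega⟩ s, r) τ)
          ∂(rollout M (deterministicPolicy e he) k (h + 1) (by omega) s') = 0 := by
        intro r s'
        rw [lintegral_congr_ae (g := 0), lintegral_zero_fun]
        refine (ih (h + 1) (by omega) s' ms).mono fun τ hτ => ?_
        refine Set.indicator_of_notMem ?_ _
        rw [Set.notMem_compl_iff]
        intro i
        refine Fin.cases ?_ (fun j => ?_) i
        · simp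
        · simp only [Fin.cons_succ, hτ j, Fin.val_succ]
          congr 2
          omega
      simp [z]
    rw [lintegral_indicator_one hm] at key
    exact key

theorem ae_trajLaw_action_eq (M : MDP S A H) {e : Fin H → S → A} (he : ∀ h, Measurable (e h)) :
    ∀ᵐ τ ∂(trajLaw M (deterministicPolicy e he)), ∀ h, (τ h).2.1 = e h (τ h).1 := by
  have ms : MeasurableSet {τ : Traj S A H | ∀ h, (τ h).2.1 = e h (τ h).1} := by
    rw [Set.ofPred_forall]
    exact MeasurableSet.iInter fun i =>
      measurableSet_eq_fun (by fun_prop) ((he _).comp (by fun_prop))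
  have key : ∫⁻ τ, Set.indicator {τ : Traj S A H | ∀ h, (τ h).2.1 = e h (τ h).1}ᶜ (1 : Traj S A H → ℝ≥0∞) τ
      ∂(trajLaw M (deterministicPolicy e he)) = 0 := by
    rw [lintegral_trajLaw _ _ ((measurable_one (α := ℝ≥0∞)).indicator ms.compl)]
    have z : ∀ s, ∫⁻ τ, Set.indicator {τ : Traj S A H | ∀ h, (τ h).2.1 = e h (τ h).1}ᶜ
        (1 : Traj S A H → ℝ≥0∞) τ ∂(rollout M (deterministicPolicy e he) H 0 (by omega) s) = 0 := by
      intro s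
      rw [lintegral_indicator_one ms.compl]
      have := ae_rollout_action_eq M he H 0 (by omega) s
      simp only [zero_add] at this
      exact this
    simp [z]
  rw [lintegral_indicator_one ms.compl] at key
  exact key

/-- Performance difference, from step `h` on. -/
theorem lexpectedReturn_rollout_deterministic_le (M : MDP S A H) {e : Fin H → S → A}
    (he : ∀ h, Measurable (e h)) {μ : ℝ} (hμ : Recoverable M (deterministicPolicy e he) μ)
    (π : Policy S A H) (k h : ℕ) (hk : h + k = H) (s : S) :
    lexpectedReturn (rollout M (deterministicPolicy e he) k h hk.le s) ≤
      ∫⁻ τ, (ENNReal.ofReal (totalReward τ) + ENNReal.ofReal μ *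
          ∑ i : Fin k, (1 - matchProb e π ⟨h + i, by omega⟩ (τ i).1))
        ∂(rollout M π k h hk.le s) := by
  induction k generalizing h s with
  | zero => simp [rollout, lexpectedReturn]
  | succ k ih =>
    have mc : Measurable fun τ : Traj S A (k + 1) => ENNReal.ofReal (totalReward τ) +
        ENNReal.ofReal μ *
          ∑ i : Fin (k + 1), (1 - matchProb e π ⟨h + i, by omega⟩ (τ i).1) :=
      measurable_ofReal_totalReward.add (Measurable.const_mul (Finset.measurable_sum _ fun i _ =>
        measurable_const.sub ((measurable_matchProb he π _).comp (by fun_prop))) _)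
    set c := 1 - matchProb e π ⟨h, by omega⟩ s with hc
    set v := lexpectedReturn (rollout M (deterministicPolicy e he) (k + 1) h hk.le s) with hv
    set P := fun a => prependStep M ⟨h, by omega⟩
      (rollout M (deterministicPolicy e he) k (h + 1) (by omega)) s a with hP
    have hprob : ∀ a, IsProbabilityMeasure (P a) := fun a =>
      isProbabilityMeasure_prependStep _ _ (measurable_rollout _ _ _ _ _) inferInstance _ _
    have hdet : v = lexpectedReturn (P (e ⟨h, by omega⟩ s)) :=
      lintegral_rollout_deterministic_succ _ _ _ _ _ _ measurable_ofReal_totalReward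
    -- `P a` is a deviation to `a` followed by the expert, so its return is the expert's `Q` value
    -- and recoverability applies.
    have hdev : ∀ a, v ≤ lexpectedReturn (P a) + ENNReal.ofReal μ := by
      intro a
      have h1 := hμ ⟨h, by omega⟩ s a
      rw [V, Q, expectedReturn_rollout_congr M _ (show H - h = k + 1 by omega) _ hk.le,
        expectedReturn_prependStep_congr M _ _ (show H - (h + 1) = k by omega) _
          (show h + 1 + k ≤ H by omega), sub_le_iff_le_add] at h1
      have h2 := ENNReal.ofReal_le_ofReal h1
      rw [ofReal_expectedReturn] at h2
      refine h2.trans (ENNReal.ofReal_add_le.trans ?_)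
      rw [add_comm]
      have : IsProbabilityMeasure (prependStep M ⟨h, by omega⟩
        (rollout M (deterministicPolicy e he) k (h + 1) (by omega)) s a) := hprob a
      rw [ofReal_expectedReturn]
    -- The price `μ` is charged only if `a` is not the expert's action; averaged over the actions of
    -- `π`, the charge is `μ * c`.
    have hv' : ∀ a, v ≤ lexpectedReturn (P a) +
        ENNReal.ofReal μ * ({e ⟨h, by omega⟩ s}ᶜ : Set A).indicator 1 a := by
      intro a
      by_cases ha : a = e ⟨h, by omega⟩ s
      · subst ha; simp [hdet]
      · simpa [ha] using hdev a
    have hstep : ∀ a, lexpectedReturn (P a) + ENNReal.ofReal μ * c ≤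
        ∫⁻ τ, (ENNReal.ofReal (totalReward τ) + ENNReal.ofReal μ *
          ∑ i : Fin (k + 1), (1 - matchProb e π ⟨h + i, by omega⟩ (τ i).1))
        ∂(prependStep M ⟨h, by omega⟩ (rollout M π k (h + 1) (by omega)) s a) := by
      intro a
      rw [lintegral_prependStep _ _ (measurable_rollout _ _ _ _ _) inferInstance _ _ mc,
        lexpectedReturn, lintegral_prependStep _ _ (measurable_rollout _ _ _ _ _) inferInstance _ _
          measurable_ofReal_totalReward]
      have e1 : ∀ x : ℝ≥0∞, ∀ m : Measure unitInterval, IsProbabilityMeasure m →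
          ∫⁻ _, x ∂m = x := by intros; simp
      have e2 : ∀ x : ℝ≥0∞, ∀ m : Measure S, IsProbabilityMeasure m →
          ∫⁻ _, x ∂m = x := by intros; simp
      -- The constant is written as an integral over a probability measure, so that it can be moved
      -- under the integral sign.
      nth_rw 1 [← e1 (ENNReal.ofReal μ * c) (M.reward (s, a)) inferInstance]
      rw [← lintegral_add_right _ measurable_const]
      refine lintegral_mono fun r => ?_
      nth_rw 1 [← e2 (ENNReal.ofReal μ * c) (M.trans ⟨h, by omega⟩ (s, a)) inferInstance]
      rw [← lintegral_add_right _ measurable_const]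
      refine lintegral_mono fun s' => ?_
      have e3 : ∀ τ : Traj S A k,
          ENNReal.ofReal (totalReward (Fin.cons (s, a, r) τ : Traj S A (k + 1))) =
            ENNReal.ofReal r + ENNReal.ofReal (totalReward τ) := fun τ => by
        rw [totalReward_cons, ENNReal.ofReal_add r.2.1 (totalReward_nonneg τ)]
      have e4 : ∀ τ : Traj S A k, ∑ i : Fin (k + 1), (1 - matchProb e π ⟨h + i, by omega⟩
            ((Fin.cons (s, a, r) τ : Traj S A (k + 1)) i).1) =
          c + ∑ i : Fin k, (1 - matchProb e π ⟨h + 1 + i, by omega⟩ (τ i).1) := fun τ => by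
        rw [Fin.sum_univ_succ]
        simp only [Fin.cons_zero, Fin.cons_succ, Fin.val_zero, Fin.val_succ, add_zero]
        have : ∀ i : Fin k, (⟨h + (i + 1), by omega⟩ : Fin H) = ⟨h + 1 + i, by omega⟩ :=
          fun i => by ext; simp; omega
        simp only [this, hc]
      have e5 : ∀ τ : Traj S A k,
          ENNReal.ofReal (totalReward (Fin.cons (s, a, r) τ : Traj S A (k + 1))) +
            ENNReal.ofReal μ * ∑ i : Fin (k + 1), (1 - matchProb e π ⟨h + i, by omega⟩
            ((Fin.cons (s, a, r) τ : Traj S A (k + 1)) i).1) =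
          (ENNReal.ofReal r + ENNReal.ofReal μ * c) + (ENNReal.ofReal (totalReward τ) +
            ENNReal.ofReal μ *
              ∑ i : Fin k, (1 - matchProb e π ⟨h + 1 + i, by omega⟩ (τ i).1)) := fun τ => by
        rw [e3, e4]; ring
      simp_rw [e5, e3]
      rw [lintegral_add_left measurable_const, lintegral_add_left measurable_const,
        lintegral_const, lintegral_const, measure_univ, measure_univ, mul_one, mul_one,
        add_right_comm]
      exact add_le_add_right (ih (h + 1) (by omega) s') _
    rw [lintegral_rollout_succ _ _ _ _ _ _ mc]
    refine le_trans ?_ (lintegral_mono hstep)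
    rw [lintegral_add_right _ measurable_const, lintegral_const, measure_univ, mul_one]
    have hcm : ∫⁻ a, ({e ⟨h, by omega⟩ s}ᶜ : Set A).indicator 1 a ∂((π ⟨h, by omega⟩).1 s) = c := by
      rw [lintegral_indicator_one (measurableSet_singleton _).compl,
        prob_compl_eq_one_sub (measurableSet_singleton _)]
      rfl
    have mi : Measurable fun a => ENNReal.ofReal μ *
        ({e ⟨h, by omega⟩ s}ᶜ : Set A).indicator (1 : A → ℝ≥0∞) a :=
      ((measurable_one (α := ℝ≥0∞)).indicator (measurableSet_singleton _).compl).const_mul _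
    calc v = ∫⁻ _, v ∂((π ⟨h, by omega⟩).1 s) := by simp
      _ ≤ _ := lintegral_mono hv'
      _ = _ := by
        rw [lintegral_add_right _ mi, lintegral_const_mul' _ _ ENNReal.ofReal_ne_top, hcm]

/-- The mass that the visitation distribution of `π` gives to deviations from the expert. -/
noncomputable def deviation (M : MDP S A H) (e : Fin H → S → A) (π : Policy S A H) : ℝ≥0∞ :=
  ∫⁻ x, (1 - matchProb e π x.1 x.2) ∂(visitLaw M π)

theorem lintegral_visitLaw (M : MDP S A H) (π : Policy S A H) {f : Fin H × S → ℝ≥0∞}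
    (hf : Measurable f) :
    ∫⁻ x, f x ∂(visitLaw M π) =
      (H : ℝ≥0∞)⁻¹ * ∫⁻ τ, ∑ h, f (h, (τ h).1) ∂(trajLaw M π) := by
  rw [visitLaw, lintegral_smul_measure, lintegral_finsetSum_measure,
    smul_eq_mul,
    lintegral_finsetSum (f := fun h (τ : Traj S A H) => f (h, (τ h).1)) _
      fun h _ => hf.comp (by fun_prop)]
  congr 1
  exact Finset.sum_congr rfl fun h _ => lintegral_map hf (by fun_prop)

/-- The sum over the steps in the performance difference bound has mean `H * deviation`, since the
step is uniform under `visitLaw`. -/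
theorem lexpectedReturn_deterministic_le (hH : 0 < H) (M : MDP S A H) {e : Fin H → S → A}
    (he : ∀ h, Measurable (e h)) {μ : ℝ} (hμ : Recoverable M (deterministicPolicy e he) μ)
    (π : Policy S A H) :
    lexpectedReturn (trajLaw M (deterministicPolicy e he)) ≤
      lexpectedReturn (trajLaw M π) + ENNReal.ofReal μ * (H * deviation M e π) := by
  have mm : Measurable fun x : Fin H × S => 1 - matchProb e π x.1 x.2 :=
    measurable_from_prod_countable_right fun h => measurable_const.sub (measurable_matchProb he π h)
  have ms : Measurable fun τ : Traj S A H => ∑ h, (1 - matchProb e π h (τ h).1) :=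
    Finset.measurable_sum _ fun i _ =>
      measurable_const.sub ((measurable_matchProb he π _).comp (by fun_prop))
  have ma : Measurable fun τ : Traj S A H => ENNReal.ofReal (totalReward τ) +
      ENNReal.ofReal μ * ∑ h, (1 - matchProb e π h (τ h).1) :=
    measurable_ofReal_totalReward.add (ms.const_mul _)
  have hH' : (H : ℝ≥0∞) ≠ 0 := by exact_mod_cast hH.ne'
  rw [deviation, lintegral_visitLaw _ _ mm, ← mul_assoc (H : ℝ≥0∞),
    ENNReal.mul_inv_cancel hH' (ENNReal.natCast_ne_top H), one_mul,
    ← lintegral_const_mul _ ms, lexpectedReturn, lexpectedReturn,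
    ← lintegral_add_left measurable_ofReal_totalReward,
    lintegral_trajLaw _ _ measurable_ofReal_totalReward,
    lintegral_trajLaw _ _ ma]
  refine lintegral_mono fun s => ?_
  simpa [lexpectedReturn] using
    lexpectedReturn_rollout_deterministic_le M he hμ π H 0 (by omega) s

end Expert

/-! ### Each-step mixtures as averages over spliced policies -/

section Mixture

variable {S A : Type*} [MeasurableSpace S] [MeasurableSpace A] [MeasurableEq A] {H : ℕ}

theorem eachStepMixture_apply [Nonempty A] (C : Finset (Policy S A H))
    {u : Policy S A H → ℝ≥0∞} (hu : ∑ π ∈ C, u π = 1) (h : Fin H) (s : S) (t : Set A) :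
    (eachStepMixture C u h).1 s t = ∑ π ∈ C, u π * (π h).1 s t := by
  rw [eachStepMixture, dif_pos hu]
  change (∑ π ∈ C, u π • (π h).1 s) t = _
  simp [Measure.coe_finsetSum]

/-- The trajectories that visit a state in which `π` may deviate from the expert. -/
def disagreement (e : Fin H → S → A) (π : Policy S A H) : Set (Traj S A H) :=
  {τ | ∃ h, matchProb e π h (τ h).1 ≠ 1}

theorem measurableSet_disagreement {e : Fin H → S → A} (he : ∀ h, Measurable (e h))
    (π : Policy S A H) : MeasurableSet (disagreement e π) := by
  rw [disagreement, Set.ofPred_exists]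
  refine MeasurableSet.iUnion fun h => MeasurableSet.compl 
    (s := {τ : Traj S A H | matchProb e π h (τ h).1 = 1}) ?_
  exact ((measurable_matchProb he π h).comp (by fun_prop : Measurable fun τ : Traj S A H => (τ h).1))
    (measurableSet_singleton 1)

/-- The chance that the mixture matches the expert along a trajectory averages the chances of the
spliced policies `fun h => i h h`, under the product weights. Each of these is `1` off the
disagreement set of that policy, so only the mass of these sets is lost, at a cost of at most `R`
per unit. -/
theorem lexpectedReturn_deterministic_le_eachStepMixture [Nonempty A] (M : MDP S A H)
    {e : Fin H → S → A} (he : ∀ h, Measurable (e h)) {R : ℝ} (hR : NormalizedReturn M R)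
    (C : Finset (Policy S A H)) {u : Policy S A H → ℝ≥0∞} (hu : ∑ π ∈ C, u π = 1) {ε : ℝ≥0∞}
    (hε : ∀ i : Fin H → Policy S A H, (∀ h, i h ∈ C) →
      trajLaw M (deterministicPolicy e he) (disagreement e fun h => i h h) ≤ ε) :
    lexpectedReturn (trajLaw M (deterministicPolicy e he)) ≤
      lexpectedReturn (trajLaw M (eachStepMixture C u)) + ENNReal.ofReal R * ε := by
  classical
  set p := Fintype.piFinset fun _ : Fin H => C with hp
  -- A product of sums is the sum over tuples of the products; the same expansion gives `hmatch`.
  have hone : ∑ i ∈ p, ∏ h, u (i h) = 1 := by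
    rw [hp, ← Finset.prod_univ_sum (fun _ : Fin H => C) fun _ π => u π]
    simp [hu]
  have hmatch : ∀ τ : Traj S A H, ∏ h, matchProb e (eachStepMixture C u) h (τ h).1 =
      ∑ i ∈ p, (∏ h, u (i h)) * ∏ h, matchProb e (i h) h (τ h).1 := by
    intro τ
    simp only [← Finset.prod_mul_distrib]
    rw [hp, ← Finset.prod_univ_sum (fun _ : Fin H => C)
      fun h π => u π * matchProb e π h (τ h).1]
    exact Finset.prod_congr rfl fun h _ => eachStepMixture_apply C hu h _ _
  have hle : ∀ τ : Traj S A H, 1 ≤ ∏ h, matchProb e (eachStepMixture C u) h (τ h).1 +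
      ∑ i ∈ p, (∏ h, u (i h)) * (disagreement e fun h => i h h).indicator 1 τ := by
    intro τ
    rw [hmatch, ← Finset.sum_add_distrib, ← hone]
    refine Finset.sum_le_sum fun i _ => ?_
    rw [← mul_add]
    refine le_mul_of_one_le_right' ?_
    by_cases hτ : τ ∈ disagreement e fun h => i h h
    · simp [hτ]
    · have h1 : ∀ h, matchProb e (i h) h (τ h).1 = 1 := by
        intro h
        by_contra hne
        exact hτ ⟨h, hne⟩
      simp [h1]
  have mm : Measurable fun τ : Traj S A H => ENNReal.ofReal (totalReward τ) *
      ∏ h, matchProb e (eachStepMixture C u) h (τ h).1 :=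
    measurable_ofReal_totalReward.mul (Finset.measurable_prod _ fun i _ =>
      (measurable_matchProb he _ _).comp (by fun_prop))
  have mi : ∀ i : Fin H → Policy S A H, Measurable
      ((disagreement e fun h => i h h).indicator (1 : Traj S A H → ℝ≥0∞)) := fun i =>
    (measurable_one (α := ℝ≥0∞)).indicator (measurableSet_disagreement he _)
  calc lexpectedReturn (trajLaw M (deterministicPolicy e he))
      ≤ ∫⁻ τ, (ENNReal.ofReal (totalReward τ) *
            ∏ h, matchProb e (eachStepMixture C u) h (τ h).1 + ENNReal.ofReal R *
            ∑ i ∈ p, (∏ h, u (i h)) * (disagreement e fun h => i h h).indicator 1 τ)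
          ∂(trajLaw M (deterministicPolicy e he)) := by
        refine lintegral_mono_ae ?_
        filter_upwards [hR (deterministicPolicy e he)] with τ hτ
        calc ENNReal.ofReal (totalReward τ) = ENNReal.ofReal (totalReward τ) * 1 := by simp
          _ ≤ ENNReal.ofReal (totalReward τ) * _ := mul_le_mul_right (hle τ) _
          _ ≤ _ := by
            rw [mul_add]
            exact add_le_add_right (mul_le_mul_left (ENNReal.ofReal_le_ofReal hτ.2) _) _
    _ ≤ _ := by
      rw [lintegral_add_left mm, lintegral_const_mul' _ _ ENNReal.ofReal_ne_top,
        lintegral_finsetSum _ fun i _ => (mi i).const_mul _]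
      refine add_le_add (lintegral_mul_matchProb_trajLaw_le M he _ measurable_ofReal_totalReward)
        (mul_le_mul_right ?_ _)
      calc _ ≤ ∑ i ∈ p, (∏ h, u (i h)) * ε := by
            refine Finset.sum_le_sum fun i hi => ?_
            rw [lintegral_const_mul _ (mi i),
              lintegral_indicator_one (measurableSet_disagreement he _)]
            exact mul_le_mul_right (hε i fun h => Fintype.mem_piFinset.1 hi h) _
        _ = ε := by rw [← Finset.sum_mul, hone, one_mul]

end Mixture

/-! ### Offline data: consistency with the expert, union bound, sizes of the classes -/

section Offline

variable {S A : Type*} [MeasurableSpace S] [MeasurableSpace A] [MeasurableEq A] {H : ℕ}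

theorem ae_offlineLaw_action_eq (M : MDP S A H) {e : Fin H → S → A} (he : ∀ h, Measurable (e h))
    (N : ℕ) : ∀ᵐ d ∂(offlineLaw M (deterministicPolicy e he) N),
      ∀ i h, (d i h).2 = e h (d i h).1 := by
  have hm : Measurable fun (τ : Traj S A H) h => ((τ h).1, (τ h).2.1) := by fun_prop
  have := Measure.isProbabilityMeasure_map (μ := trajLaw M (deterministicPolicy e he))
    hm.aemeasurable
  have h1 : ∀ᵐ x ∂((trajLaw M (deterministicPolicy e he)).map
      fun τ h => ((τ h).1, (τ h).2.1)), ∀ h, (x h).2 = e h (x h).1 := by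
    rw [ae_map_iff hm.aemeasurable]
    · exact ae_trajLaw_action_eq M he
    · rw [Set.ofPred_forall]
      exact MeasurableSet.iInter fun h =>
        measurableSet_eq_fun (by fun_prop) ((he h).comp (by fun_prop))
  refine Filter.eventually_all.2 fun i => ?_
  exact (Measure.tendsto_eval_ae_ae (μ := fun _ : Fin N =>
    (trajLaw M (deterministicPolicy e he)).map fun τ h => ((τ h).1, (τ h).2.1))
      (i := i)).eventually h1

/-- With small probability, some policy of the class is never caught by the offline data although
it often visits states in which it may deviate from the expert. -/
theorem offlineLaw_undetected_le (M : MDP S A H) {e : Fin H → S → A} (he : ∀ h, Measurable (e h))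
    (K : Finset (Policy S A H)) (N : ℕ) (ε : ℝ) :
    MeasurableSet {d : Dataset S A H N | ∃ π ∈ K,
        ε < (trajLaw M (deterministicPolicy e he)).real (disagreement e π) ∧
          ∀ i h, matchProb e π h (d i h).1 = 1} ∧
    offlineLaw M (deterministicPolicy e he) N {d | ∃ π ∈ K,
        ε < (trajLaw M (deterministicPolicy e he)).real (disagreement e π) ∧
          ∀ i h, matchProb e π h (d i h).1 = 1}
      ≤ ENNReal.ofReal (K.card * Real.exp (-(N * ε))) := by
  classical
  set P := trajLaw M (deterministicPolicy e he)
  have hm : Measurable fun (τ : Traj S A H) h => ((τ h).1, (τ h).2.1) := by fun_prop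
  have hprob := Measure.isProbabilityMeasure_map (μ := P) hm.aemeasurable
  have mx : ∀ π : Policy S A H,
      MeasurableSet {x : Fin H → S × A | ∀ h, matchProb e π h (x h).1 = 1} := fun π => by
    rw [Set.ofPred_forall]
    exact MeasurableSet.iInter fun h => ((measurable_matchProb he π h).comp
      (by fun_prop : Measurable fun x : Fin H → S × A => (x h).1)) (measurableSet_singleton 1)
  -- For a fixed policy, escaping detection is a product event over the independent trajectories.
  have hset : {d : Dataset S A H N | ∃ π ∈ K, ε < P.real (disagreement e π) ∧
        ∀ i h, matchProb e π h (d i h).1 = 1} =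
      ⋃ π ∈ K.filter fun π => ε < P.real (disagreement e π),
        Set.univ.pi fun _ : Fin N => {x : Fin H → S × A | ∀ h, matchProb e π h (x h).1 = 1} := by
    ext d
    simp [Set.mem_pi, and_assoc]
  rw [hset]
  refine ⟨Finset.measurableSet_biUnion _ fun π _ => MeasurableSet.univ_pi fun _ => mx π, ?_⟩
  refine (measure_biUnion_finset_le _ _).trans ?_
  have h1 : ∀ π ∈ K.filter fun π => ε < P.real (disagreement e π),
      offlineLaw M (deterministicPolicy e he) N (Set.univ.pi fun _ : Fin N =>
        {x : Fin H → S × A | ∀ h, matchProb e π h (x h).1 = 1})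
      ≤ ENNReal.ofReal (Real.exp (-(N * ε))) := by
    intro π hπ
    have hq := (Finset.mem_filter.1 hπ).2
    rw [offlineLaw, Measure.pi_pi, Finset.prod_const, Finset.card_univ, Fintype.card_fin,
      Measure.map_apply hm (mx π)]
    have hc : (fun (τ : Traj S A H) h => ((τ h).1, (τ h).2.1)) ⁻¹'
        {x : Fin H → S × A | ∀ h, matchProb e π h (x h).1 = 1} = (disagreement e π)ᶜ := by
      ext τ
      simp [disagreement]
    rw [hc, ← ofReal_measureReal, ← ENNReal.ofReal_pow measureReal_nonneg,
      probReal_compl_eq_one_sub (measurableSet_disagreement he π)]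
    refine ENNReal.ofReal_le_ofReal ?_
    -- With `q > ε` the disagreement probability, `(1 - q) ^ N ≤ exp (-ε) ^ N`, because `1 - q ≤ 1 -
    -- ε ≤ exp (-ε)`.
    rw [show -(N * ε) = N * -ε by ring, Real.exp_nat_mul]
    refine pow_le_pow_left₀ (by linarith [measureReal_le_one (μ := P) (s := disagreement e π)]) ?_ _
    linarith [Real.add_one_le_exp (-ε)]
  refine (Finset.sum_le_card_nsmul _ _ _ h1).trans ?_
  rw [nsmul_eq_mul, ENNReal.ofReal_mul (by positivity), ENNReal.ofReal_natCast]
  gcongr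
  exact Finset.filter_subset _ _

theorem matchProb_eq_one_of_mem_bcClass {N : ℕ} {B : Finset (Policy S A H)}
    {d : Dataset S A H N} {e : Fin H → S → A} (hd : ∀ i h, (d i h).2 = e h (d i h).1)
    {π : Policy S A H} (hπ : π ∈ bcClass B d) (i : Fin N) (h : Fin H) :
    matchProb e π h (d i h).1 = 1 := by
  classical
  have := (Finset.mem_filter.1 hπ).2 i h
  rw [matchProb, this, hd]
  simp

theorem deterministicPolicy_mem_bcClass {N : ℕ} {B : Finset (Policy S A H)}
    {d : Dataset S A H N} {e : Fin H → S → A} {he : ∀ h, Measurable (e h)}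
    (hB : deterministicPolicy e he ∈ B) (hd : ∀ i h, (d i h).2 = e h (d i h).1) :
    deterministicPolicy e he ∈ bcClass B d := by
  classical
  refine Finset.mem_filter.2 ⟨hB, fun i h => ?_⟩
  rw [hd]
  exact Kernel.deterministic_apply (he h) _

theorem bcClass_subset {N : ℕ} (B : Finset (Policy S A H)) (d : Dataset S A H N) :
    bcClass B d ⊆ B := by
  classical
  exact Finset.filter_subset _ _

theorem card_bcClass_le {N : ℕ} (B : Finset (Policy S A H)) (d : Dataset S A H N) :
    (bcClass B d).card ≤ B.card :=
  Finset.card_le_card (bcClass_subset B d)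

theorem card_le_card_eachStepCompletion (B : Finset (Policy S A H)) :
    B.card ≤ (eachStepCompletion B).card := by
  classical
  exact Finset.card_le_card fun π hπ =>
    Fintype.mem_piFinset.2 fun h => Finset.mem_image_of_mem _ hπ

theorem card_eachStepCompletion_le (B : Finset (Policy S A H)) :
    (eachStepCompletion B).card ≤ B.card ^ H := by
  classical
  rw [eachStepCompletion, Fintype.card_piFinset]
  refine (Finset.prod_le_pow_card _ _ B.card fun h _ => Finset.card_image_le).trans ?_
  simp

theorem mem_eachStepCompletion {B : Finset (Policy S A H)} {i : Fin H → Policy S A H}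
    (hi : ∀ h, i h ∈ B) : (fun h => i h h) ∈ eachStepCompletion B := by
  classical
  exact Fintype.mem_piFinset.2 fun h => Finset.mem_image_of_mem (fun π : Policy S A H => π h) (hi h)

end Offline

/-! ### Exponential weights as likelihoods -/

section Weights

variable {S A : Type*} [MeasurableSpace S] [MeasurableSpace A] [MeasurableEq A] {H : ℕ}

/-- At learning rate `1` the exponential undoes the logarithm of the loss. This includes infinite
loss, which corresponds to a factor `0`. -/
theorem expWeight_eq_prod {n : ℕ} (π : Policy S A H) (obs : Fin n → Obs S A H) :
    expWeight π obs = ∏ i, (π (obs i).1).1 (obs i).2.1 {(obs i).2.2} := by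
  have gen : ∀ s : Finset (Fin n), ∑ i ∈ s, logLoss π (obs i) =
      ENNReal.log (∏ i ∈ s, ((π (obs i).1).1 (obs i).2.1 {(obs i).2.2})⁻¹) := by
    intro s
    induction s using Finset.induction_on with
    | empty => simp
    | insert a s ha ih =>
      rw [Finset.sum_insert ha, Finset.prod_insert ha, ENNReal.log_mul_add, ih, logLoss]
  rw [expWeight, gen, ← ENNReal.log_inv, ENNReal.exp_log, ← ENNReal.prod_inv_distrib]
  · simp
  · intro i _ j _ _
    exact Or.inr (measure_ne_top _ _)

theorem expWeight_le_one {n : ℕ} (π : Policy S A H) (obs : Fin n → Obs S A H) :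
    expWeight π obs ≤ 1 := by
  rw [expWeight_eq_prod]
  exact Finset.prod_le_one' fun i _ => prob_le_one

theorem expWeight_snoc {n : ℕ} (π : Policy S A H) (obs : Fin n → Obs S A H) (o : Obs S A H) :
    expWeight π (Fin.snoc obs o : Fin (n + 1) → Obs S A H) =
      expWeight π obs * (π o.1).1 o.2.1 {o.2.2} := by
  simp only [expWeight_eq_prod, Fin.prod_univ_castSucc, Fin.snoc_castSucc, Fin.snoc_last]

theorem expWeight_deterministicPolicy {n : ℕ} {e : Fin H → S → A} (he : ∀ h, Measurable (e h))
    {obs : Fin n → Obs S A H} (hobs : ∀ i, (obs i).2.2 = e (obs i).1 (obs i).2.1) :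
    expWeight (deterministicPolicy e he) obs = 1 := by
  rw [expWeight_eq_prod]
  refine Finset.prod_eq_one fun i _ => ?_
  rw [hobs, deterministicPolicy, Kernel.deterministic_apply]
  simp

theorem sum_expWeight_ne_top {N n : ℕ} (B : Finset (Policy S A H)) (d : Dataset S A H N)
    (obs : Fin n → Obs S A H) : ∑ π ∈ bcClass B d, expWeight π obs ≠ ∞ :=
  ENNReal.sum_ne_top.2 fun π _ => ne_top_of_le_ne_top ENNReal.one_ne_top (expWeight_le_one π obs)

theorem sum_expWeight_div {N n : ℕ} (B : Finset (Policy S A H)) (d : Dataset S A H N)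
    (obs : Fin n → Obs S A H) (h0 : ∑ π ∈ bcClass B d, expWeight π obs ≠ 0) :
    ∑ π ∈ bcClass B d, expWeight π obs / ∑ π' ∈ bcClass B d, expWeight π' obs = 1 := by
  simp only [div_eq_mul_inv]
  rw [← Finset.sum_mul]
  exact ENNReal.mul_inv_cancel h0 (sum_expWeight_ne_top B d obs)

/-- The played policy is the Bayes mixture, so its probability of the next annotation is the ratio
of successive total weights. If the total weight is `0`, the played policy is a fallback, but both
sides vanish. -/
theorem sum_expWeight_snoc [Nonempty A] {N n : ℕ} (B : Finset (Policy S A H))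
    (d : Dataset S A H N) (obs : Fin n → Obs S A H) (o : Obs S A H) :
    ∑ π ∈ bcClass B d, expWeight π (Fin.snoc obs o : Fin (n + 1) → Obs S A H) =
      (∑ π ∈ bcClass B d, expWeight π obs) *
        (warmStaggerPolicy B d obs o.1).1 o.2.1 {o.2.2} := by
  simp only [expWeight_snoc]
  by_cases h0 : ∑ π ∈ bcClass B d, expWeight π obs = 0
  · rw [h0, zero_mul]
    refine Finset.sum_eq_zero fun π hπ => ?_
    rw [Finset.sum_eq_zero_iff.1 h0 π hπ, zero_mul]
  · rw [warmStaggerPolicy, eachStepMixture_apply _ (sum_expWeight_div B d obs h0),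
      Finset.mul_sum]
    refine Finset.sum_congr rfl fun π _ => ?_
    rw [← mul_assoc, ENNReal.mul_div_cancel h0 (sum_expWeight_ne_top B d obs)]

end Weights

/-! ### The law of the interaction and the supermartingale -/

section Interaction

variable {S A : Type*} [MeasurableSpace S] [MeasurableSpace A] [MeasurableEq A] [Nonempty A]
  {H : ℕ} [NeZero H]

theorem isProbabilityMeasure_visitLaw (M : MDP S A H) (π : Policy S A H) :
    IsProbabilityMeasure (visitLaw M π) :=
  (visitLaw_wf M (Θ := Unit) (π := fun _ => π)
    fun h => (π h).1.measurable.comp measurable_snd).2 ()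

theorem measurable_visitLaw_warmStaggerPolicy (M : MDP S A H) (B : Finset (Policy S A H))
    (N n : ℕ) : Measurable fun ω : Dataset S A H N × (Fin n → Obs S A H) =>
      visitLaw M (warmStaggerPolicy B ω.1 ω.2) :=
  (visitLaw_wf M (π := fun ω : Dataset S A H N × (Fin n → Obs S A H) =>
    warmStaggerPolicy B ω.1 ω.2) (measurable_warmStaggerPolicy B)).1

theorem measurable_snoc_annotated {e : Fin H → S → A} (he : ∀ h, Measurable (e h)) (N n : ℕ) :
    Measurable fun p : (Dataset S A H N × (Fin n → Obs S A H)) × (Fin H × S) =>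
      (p.1.1, (Fin.snoc p.1.2 (p.2.1, p.2.2, e p.2.1 p.2.2) : Fin (n + 1) → Obs S A H)) := by
  have hE : Measurable fun x : Fin H × S => e x.1 x.2 :=
    measurable_from_prod_countable_right fun h => he h
  refine measurable_fst.fst.prodMk (measurable_finSnoc.comp (measurable_fst.snd.prodMk ?_))
  exact measurable_snd.fst.prodMk (measurable_snd.snd.prodMk (hE.comp measurable_snd))

theorem lintegral_interactionLaw_zero (M : MDP S A H) (B : Finset (Policy S A H))
    {e : Fin H → S → A} (he : ∀ h, Measurable (e h)) (N : ℕ)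
    {f : Dataset S A H N × (Fin 0 → Obs S A H) → ℝ≥0∞} (hf : Measurable f) :
    ∫⁻ ω, f ω ∂(interactionLaw M B e he N 0) =
      ∫⁻ d, f (d, fun i => i.elim0) ∂(offlineLaw M (deterministicPolicy e he) N) := by
  rw [interactionLaw, lintegral_map hf (by fun_prop)]

theorem lintegral_interactionLaw_succ (M : MDP S A H) (B : Finset (Policy S A H))
    {e : Fin H → S → A} (he : ∀ h, Measurable (e h)) (N n : ℕ)
    {f : Dataset S A H N × (Fin (n + 1) → Obs S A H) → ℝ≥0∞} (hf : Measurable f) :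
    ∫⁻ ω, f ω ∂(interactionLaw M B e he N (n + 1)) =
      ∫⁻ ω, ∫⁻ x, f (ω.1, (Fin.snoc ω.2 (x.1, x.2, e x.1 x.2) : Fin (n + 1) → Obs S A H))
        ∂(visitLaw M (warmStaggerPolicy B ω.1 ω.2)) ∂(interactionLaw M B e he N n) := by
  have hs := measurable_snoc_annotated he N n
  rw [interactionLaw, Measure.lintegral_bind
    (measurable_map_param (measurable_visitLaw_warmStaggerPolicy M B N n)
      (fun _ => isProbabilityMeasure_visitLaw _ _) hs).aemeasurable hf.aemeasurable]
  exact lintegral_congr fun ω => lintegral_map hf (hs.comp measurable_prodMk_left)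

theorem lintegral_interactionLaw_fst (M : MDP S A H) (B : Finset (Policy S A H))
    {e : Fin H → S → A} (he : ∀ h, Measurable (e h)) (N n : ℕ)
    {f : Dataset S A H N → ℝ≥0∞} (hf : Measurable f) :
    ∫⁻ ω, f ω.1 ∂(interactionLaw M B e he N n) =
      ∫⁻ d, f d ∂(offlineLaw M (deterministicPolicy e he) N) := by
  induction n with
  | zero => exact lintegral_interactionLaw_zero M B he N (hf.comp measurable_fst)
  | succ n ih =>
    rw [lintegral_interactionLaw_succ M B he N n (f := fun ω => f ω.1) (hf.comp measurable_fst),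
      ← ih]
    refine lintegral_congr fun ω => ?_
    have := isProbabilityMeasure_visitLaw M (warmStaggerPolicy B ω.1 ω.2)
    simp

/-- The rounds never alter the data set, so offline probability bounds transfer to the joint law. -/
theorem interactionLaw_preimage_fst (M : MDP S A H) (B : Finset (Policy S A H))
    {e : Fin H → S → A} (he : ∀ h, Measurable (e h)) (N n : ℕ)
    {t : Set (Dataset S A H N)} (ht : MeasurableSet t) :
    interactionLaw M B e he N n (Prod.fst ⁻¹' t) =
      offlineLaw M (deterministicPolicy e he) N t := by
  rw [← lintegral_indicator_one ht, ← lintegral_indicator_one (measurable_fst ht),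
    ← lintegral_interactionLaw_fst M B he N n ((measurable_one (α := ℝ≥0∞)).indicator ht)]
  rfl

theorem ae_interactionLaw_data (M : MDP S A H) (B : Finset (Policy S A H))
    {e : Fin H → S → A} (he : ∀ h, Measurable (e h)) (N n : ℕ) :
    ∀ᵐ ω ∂(interactionLaw M B e he N n), ∀ i h, (ω.1 i h).2 = e h (ω.1 i h).1 := by
  have ms : MeasurableSet {d : Dataset S A H N | ∀ i h, (d i h).2 = e h (d i h).1} := by
    simp only [Set.ofPred_forall]
    exact MeasurableSet.iInter fun i => MeasurableSet.iInter fun h =>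
      measurableSet_eq_fun (by fun_prop) ((he h).comp (by fun_prop))
  have := interactionLaw_preimage_fst M B he N n ms.compl
  rw [ae_iff]
  exact this.trans (ae_offlineLaw_action_eq M he N)

theorem ae_interactionLaw_annotation (M : MDP S A H) (B : Finset (Policy S A H))
    {e : Fin H → S → A} (he : ∀ h, Measurable (e h)) (N n : ℕ) :
    ∀ᵐ ω ∂(interactionLaw M B e he N n), ∀ i, (ω.2 i).2.2 = e (ω.2 i).1 (ω.2 i).2.1 := by
  have hE : Measurable fun x : Fin H × S => e x.1 x.2 :=
    measurable_from_prod_countable_right fun h => he h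
  induction n with
  | zero => exact Filter.Eventually.of_forall fun ω i => i.elim0
  | succ n ih =>
    have ms : MeasurableSet {ω : Dataset S A H N × (Fin (n + 1) → Obs S A H) |
        ∀ i, (ω.2 i).2.2 = e (ω.2 i).1 (ω.2 i).2.1} := by
      simp only [Set.ofPred_forall]
      exact MeasurableSet.iInter fun i => measurableSet_eq_fun (by fun_prop) (hE.comp
        (by fun_prop : Measurable fun ω : Dataset S A H N × (Fin (n + 1) → Obs S A H) =>
          ((ω.2 i).1, (ω.2 i).2.1)))
    have key := lintegral_interactionLaw_succ M B he N n
      ((measurable_one (α := ℝ≥0∞)).indicator ms.compl)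
    rw [lintegral_indicator_one ms.compl] at key
    refine Eq.trans (b := interactionLaw M B e he N (n + 1) _) rfl (key.trans ?_)
    rw [lintegral_congr_ae (g := 0), lintegral_zero_fun]
    filter_upwards [ih] with ω hω
    have z : ∀ x : Fin H × S, Set.indicator {ω : Dataset S A H N × (Fin (n + 1) → Obs S A H) |
        ∀ i, (ω.2 i).2.2 = e (ω.2 i).1 (ω.2 i).2.1}ᶜ
        (1 : Dataset S A H N × (Fin (n + 1) → Obs S A H) → ℝ≥0∞)
        (ω.1, (Fin.snoc ω.2 (x.1, x.2, e x.1 x.2) : Fin (n + 1) → Obs S A H)) = 0 := by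
      intro x
      refine Set.indicator_of_notMem ?_ _
      rw [Set.notMem_compl_iff]
      intro i
      refine Fin.lastCases ?_ (fun j => ?_) i
      · simp
      · simpa using hω j
    simp [z]

/-- The sum of the deviations of the policies played in the first `n` rounds. -/
noncomputable def cumulativeDeviation (M : MDP S A H) (B : Finset (Policy S A H))
    (e : Fin H → S → A) {N n : ℕ} (d : Dataset S A H N) (obs : Fin n → Obs S A H) : ℝ≥0∞ :=
  ∑ m : Fin n, deviation M e (warmStaggerPolicy B d fun i : Fin m => obs (i.castLE m.isLt.le))

theorem deviation_le_one (M : MDP S A H) (e : Fin H → S → A) (π : Policy S A H) :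
    deviation M e π ≤ 1 := by
  have := isProbabilityMeasure_visitLaw M π
  calc deviation M e π ≤ ∫⁻ _, 1 ∂(visitLaw M π) := lintegral_mono fun x => tsub_le_self
    _ = 1 := by simp

theorem deviation_ne_top (M : MDP S A H) (e : Fin H → S → A) (π : Policy S A H) :
    deviation M e π ≠ ∞ := ne_top_of_le_ne_top ENNReal.one_ne_top (deviation_le_one M e π)

theorem cumulativeDeviation_snoc (M : MDP S A H) (B : Finset (Policy S A H))
    (e : Fin H → S → A) {N n : ℕ} (d : Dataset S A H N) (obs : Fin n → Obs S A H)
    (o : Obs S A H) :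
    cumulativeDeviation M B e d (Fin.snoc obs o : Fin (n + 1) → Obs S A H) =
      cumulativeDeviation M B e d obs + deviation M e (warmStaggerPolicy B d obs) := by
  rw [cumulativeDeviation, Fin.sum_univ_castSucc]
  congr 1
  · refine Finset.sum_congr rfl fun m _ => ?_
    congr 2
    funext i
    exact Fin.snoc_castSucc (α := fun _ => Obs S A H) o obs (i.castLE m.isLt.le)
  · congr 2
    funext i
    exact Fin.snoc_castSucc (α := fun _ => Obs S A H) o obs i

theorem cumulativeDeviation_ne_top (M : MDP S A H) (B : Finset (Policy S A H))
    (e : Fin H → S → A) {N n : ℕ} (d : Dataset S A H N) (obs : Fin n → Obs S A H) :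
    cumulativeDeviation M B e d obs ≠ ∞ :=
  ENNReal.sum_ne_top.2 fun _ _ => deviation_ne_top M e _

theorem measurable_deviation_param (M : MDP S A H) {e : Fin H → S → A}
    (he : ∀ h, Measurable (e h)) {Θ : Type*} [MeasurableSpace Θ] {π : Θ → Policy S A H}
    (hπ : ∀ h, Measurable fun p : Θ × S => (π p.1 h).1 p.2) :
    Measurable fun θ => deviation M e (π θ) := by
  let K : Kernel Θ (Fin H × S) := ⟨fun θ => visitLaw M (π θ), (visitLaw_wf M hπ).1⟩
  have : IsMarkovKernel K := ⟨fun _ => isProbabilityMeasure_visitLaw _ _⟩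
  have h1 : Measurable fun q : Fin H × (Θ × S) => 1 - matchProb e (π q.2.1) q.1 q.2.2 :=
    measurable_from_prod_countable_right fun h =>
      measurable_const.sub (measurable_matchProb_param he h (hπ h))
  have hr : Measurable fun q : Θ × (Fin H × S) => (q.2.1, (q.1, q.2.2)) := by fun_prop
  exact Measurable.lintegral_kernel_prod_right' (κ := K) (h1.comp hr)

theorem measurable_deviation_warmStaggerPolicy (M : MDP S A H) (B : Finset (Policy S A H))
    {e : Fin H → S → A} (he : ∀ h, Measurable (e h)) (N n : ℕ) :
    Measurable fun ω : Dataset S A H N × (Fin n → Obs S A H) =>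
      deviation M e (warmStaggerPolicy B ω.1 ω.2) :=
  measurable_deviation_param M he
    (π := fun ω : Dataset S A H N × (Fin n → Obs S A H) => warmStaggerPolicy B ω.1 ω.2)
    fun h => measurable_warmStaggerPolicy B h

theorem measurable_cumulativeDeviation (M : MDP S A H) (B : Finset (Policy S A H))
    {e : Fin H → S → A} (he : ∀ h, Measurable (e h)) (N n : ℕ) :
    Measurable fun ω : Dataset S A H N × (Fin n → Obs S A H) =>
      cumulativeDeviation M B e ω.1 ω.2 := by
  have hm : ∀ m : Fin n, Measurable fun ω : Dataset S A H N × (Fin n → Obs S A H) =>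
      (ω.1, fun i : Fin m => ω.2 (i.castLE m.isLt.le)) := fun m =>
    measurable_fst.prodMk (measurable_pi_lambda _ fun i =>
      (measurable_pi_apply _).comp measurable_snd)
  have hd : ∀ m : Fin n, Measurable fun ω : Dataset S A H N × (Fin n → Obs S A H) =>
      deviation M e (warmStaggerPolicy B ω.1 fun i : Fin m => ω.2 (i.castLE m.isLt.le)) := by
    intro m
    have h := (measurable_deviation_warmStaggerPolicy M B he N m).comp (hm m)
    simpa only [Function.comp_def] using h
  simp only [cumulativeDeviation]
  exact Finset.measurable_sum _ fun m _ => hd m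

theorem measurableSet_mem_bcClass (B : Finset (Policy S A H)) (N : ℕ) (π : Policy S A H) :
    MeasurableSet {d : Dataset S A H N | π ∈ bcClass B d} := by
  classical
  by_cases hπ : π ∈ B
  · have he : {d : Dataset S A H N | π ∈ bcClass B d} =
        ⋂ i, ⋂ h, {d | (π h).1 (d i h).1 {(d i h).2} = 1} := by
      ext d
      simp only [bcClass, Finset.mem_filter, hπ, true_and, Set.mem_ofPred_eq, Set.mem_iInter]
      refine forall_congr' fun i => forall_congr' fun h => ⟨fun hd => by simp [hd], fun hd => ?_⟩
      -- Full mass at one point makes `id` almost everywhere constant; comparing the two image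
      -- measures shows that the measure is a point mass.
      have hae : ∀ᵐ a ∂((π h).1 (d i h).1), a = (d i h).2 := by
        have := (prob_compl_eq_zero_iff (μ := (π h).1 (d i h).1)
          (measurableSet_singleton (d i h).2)).2 hd
        rw [ae_iff]
        exact this
      simpa using Measure.map_congr (f := id) (g := fun _ => (d i h).2) hae
    rw [he]
    refine MeasurableSet.iInter fun i => MeasurableSet.iInter fun h => ?_
    have hl : Measurable fun x : S × A => (π h).1 x.1 {x.2} := by
      have ht : MeasurableSet {p : (S × A) × A | p.2 = p.1.2} :=
        measurableSet_eq_fun measurable_snd measurable_fst.snd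
      exact Kernel.measurable_kernel_prodMk_left
        (κ := (π h).1.comap (Prod.fst : S × A → S) measurable_fst) ht
    exact (hl.comp (by fun_prop : Measurable fun d : Dataset S A H N => d i h))
      (measurableSet_singleton 1)
  · simp [bcClass, hπ]

theorem measurable_sum_bcClass (B : Finset (Policy S A H)) {N : ℕ} {Θ : Type*}
    [MeasurableSpace Θ] {f : Policy S A H → Dataset S A H N × Θ → ℝ≥0∞}
    (hf : ∀ π, Measurable (f π)) : Measurable fun ω => ∑ π ∈ bcClass B ω.1, f π ω := by
  classical
  have h1 : ∀ ω : Dataset S A H N × Θ, ∑ π ∈ bcClass B ω.1, f π ω =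
      ∑ π ∈ B, if π ∈ bcClass B ω.1 then f π ω else 0 := fun ω => by
    rw [← Finset.sum_filter]
    refine Finset.sum_congr ?_ fun _ _ => rfl
    ext π
    simp only [bcClass, Finset.mem_filter]
    tauto
  simp_rw [h1]
  exact Finset.measurable_sum _ fun π _ => Measurable.ite
    (measurable_fst (measurableSet_mem_bcClass B N π)) (hf π) measurable_const

/-- The average likelihood of the annotations under the class, times the exponential of the
cumulative deviation: a supermartingale. -/
noncomputable def potential (M : MDP S A H) (B : Finset (Policy S A H)) (e : Fin H → S → A)
    {N n : ℕ} (d : Dataset S A H N) (obs : Fin n → Obs S A H) : ℝ≥0∞ :=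
  (∑ π ∈ bcClass B d, expWeight π obs) / (bcClass B d).card *
    ENNReal.ofReal (Real.exp (cumulativeDeviation M B e d obs).toReal)

theorem measurable_potential (M : MDP S A H) (B : Finset (Policy S A H))
    {e : Fin H → S → A} (he : ∀ h, Measurable (e h)) (N n : ℕ) :
    Measurable fun ω : Dataset S A H N × (Fin n → Obs S A H) => potential M B e ω.1 ω.2 := by
  have h1 : Measurable fun ω : Dataset S A H N × (Fin n → Obs S A H) =>
      ((bcClass B ω.1).card : ℝ≥0∞) := by
    simpa using measurable_sum_bcClass B
      (f := fun _ (_ : Dataset S A H N × (Fin n → Obs S A H)) => 1) fun _ => measurable_const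
  have h2 := measurable_sum_bcClass B (N := N) (Θ := Fin n → Obs S A H)
    (f := fun π ω => expWeight π ω.2) fun π => (measurable_expWeight π).comp measurable_snd
  exact (h2.div h1).mul
    (Real.measurable_exp.comp (measurable_cumulativeDeviation M B he N n).ennreal_toReal).ennreal_ofReal

/-- The left side is `1 - deviation`, and `1 - x ≤ exp (-x)`. -/
theorem lintegral_matchProb_visitLaw_le (M : MDP S A H) {e : Fin H → S → A}
    (he : ∀ h, Measurable (e h)) (π : Policy S A H) :
    ∫⁻ x, matchProb e π x.1 x.2 ∂(visitLaw M π) ≤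
      ENNReal.ofReal (Real.exp (-(deviation M e π).toReal)) := by
  have := isProbabilityMeasure_visitLaw M π
  have mm : Measurable fun x : Fin H × S => matchProb e π x.1 x.2 :=
    measurable_from_prod_countable_right fun h => measurable_matchProb he π h
  have h1 : ∫⁻ x, matchProb e π x.1 x.2 ∂(visitLaw M π) + deviation M e π = 1 := by
    rw [deviation, ← lintegral_add_left mm]
    simp only [add_tsub_cancel_of_le (matchProb_le_one e π _ _)]
    simp
  rw [ENNReal.eq_sub_of_add_eq (deviation_ne_top M e π) h1,
    ← ENNReal.ofReal_toReal (deviation_ne_top M e π), ← ENNReal.ofReal_one,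
    ← ENNReal.ofReal_sub _ ENNReal.toReal_nonneg, ENNReal.toReal_ofReal ENNReal.toReal_nonneg]
  refine ENNReal.ofReal_le_ofReal ?_
  linarith [Real.add_one_le_exp (-(deviation M e π).toReal)]

/-- The next deviation `g` is fixed by the past. The new round therefore contributes the constant
`exp g` and a random likelihood factor of mean at most `exp (-g)`. -/
theorem lintegral_potential_snoc_le (M : MDP S A H) (B : Finset (Policy S A H))
    {e : Fin H → S → A} (he : ∀ h, Measurable (e h)) {N n : ℕ} (d : Dataset S A H N)
    (obs : Fin n → Obs S A H) :
    ∫⁻ x, potential M B e d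
        (Fin.snoc obs (x.1, x.2, e x.1 x.2) : Fin (n + 1) → Obs S A H)
      ∂(visitLaw M (warmStaggerPolicy B d obs)) ≤ potential M B e d obs := by
  set π := warmStaggerPolicy B d obs with hπ
  set g := (deviation M e π).toReal with hg
  have h1 : ∀ x : Fin H × S, potential M B e d
      (Fin.snoc obs (x.1, x.2, e x.1 x.2) : Fin (n + 1) → Obs S A H) =
      potential M B e d obs * ENNReal.ofReal (Real.exp g) * matchProb e π x.1 x.2 := by
    intro x
    rw [potential, potential, sum_expWeight_snoc, cumulativeDeviation_snoc,
      ENNReal.toReal_add (cumulativeDeviation_ne_top M B e d obs) (deviation_ne_top M e _),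
      Real.exp_add, ENNReal.ofReal_mul (Real.exp_pos _).le, matchProb]
    simp only [div_eq_mul_inv]
    ring
  simp_rw [h1]
  have mm : Measurable fun x : Fin H × S => matchProb e π x.1 x.2 :=
    measurable_from_prod_countable_right fun h => measurable_matchProb he π h
  rw [lintegral_const_mul _ mm]
  calc _ ≤ potential M B e d obs * ENNReal.ofReal (Real.exp g) *
        ENNReal.ofReal (Real.exp (-g)) :=
        mul_le_mul_right (lintegral_matchProb_visitLaw_le M he π) _
    _ = potential M B e d obs := by
      rw [mul_assoc, ← ENNReal.ofReal_mul (Real.exp_pos _).le, ← Real.exp_add]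
      simp

theorem lintegral_potential_le_one (M : MDP S A H) (B : Finset (Policy S A H))
    {e : Fin H → S → A} (he : ∀ h, Measurable (e h)) (N n : ℕ) :
    ∫⁻ ω, potential M B e ω.1 ω.2 ∂(interactionLaw M B e he N n) ≤ 1 := by
  have hm := measurable_potential M B he N
  induction n with
  | zero =>
    have := isProbabilityMeasure_interactionLaw M B e he N 0
    calc _ ≤ ∫⁻ _, 1 ∂(interactionLaw M B e he N 0) := by
          refine lintegral_mono fun ω => ?_
          -- All weights are `1` at the start, so the potential is `card / card`. This is `0` for an
          -- empty class, hence an inequality.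
          simp [potential, expWeight_eq_prod, cumulativeDeviation, ENNReal.div_self_le_one]
      _ = 1 := by simp
  | succ n ih =>
    rw [lintegral_interactionLaw_succ M B he N n (hm (n + 1))]
    have key : ∀ ω : Dataset S A H N × (Fin n → Obs S A H),
        ∫⁻ x, potential M B e ω.1
          (Fin.snoc ω.2 (x.1, x.2, e x.1 x.2) : Fin (n + 1) → Obs S A H)
        ∂(visitLaw M (warmStaggerPolicy B ω.1 ω.2)) ≤ potential M B e ω.1 ω.2 := fun ω =>
      lintegral_potential_snoc_le M B he ω.1 ω.2
    exact (lintegral_mono key).trans ih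

end Interaction

/-! ### From deviations and disagreements to regret -/

section Regret

variable {S A : Type*} [MeasurableSpace S] [MeasurableSpace A] [MeasurableEq A] {H : ℕ}

/-- At the expert's own action `V` and `Q` agree; a state exists because the initial law is a
probability measure. -/
theorem recoverable_nonneg (hH : 0 < H) (M : MDP S A H) {e : Fin H → S → A}
    (he : ∀ h, Measurable (e h)) {μ : ℝ} (hμ : Recoverable M (deterministicPolicy e he) μ) :
    0 ≤ μ := by
  obtain ⟨s⟩ : Nonempty S := nonempty_of_isProbabilityMeasure M.init
  have h1 := hμ ⟨0, hH⟩ s (e ⟨0, hH⟩ s)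
  have h2 : V M (deterministicPolicy e he) ⟨0, hH⟩ s =
      Q M (deterministicPolicy e he) ⟨0, hH⟩ s (e ⟨0, hH⟩ s) := by
    rw [V, Q, expectedReturn_rollout_congr M _
      (show H - ((⟨0, hH⟩ : Fin H) : ℕ) = H - (0 + 1) + 1 by simp; omega) _ (by simp; omega),
      expectedReturn_eq_toReal, expectedReturn_eq_toReal]
    congr 1
    exact lintegral_rollout_deterministic_succ _ _ _ _ _ _ measurable_ofReal_totalReward
  linarith

theorem normalizedReturn_nonneg {M : MDP S A H} (π : Policy S A H) {R : ℝ}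
    (hR : NormalizedReturn M R) : 0 ≤ R := by
  obtain ⟨τ, hτ⟩ := (hR π).exists
  exact hτ.1.trans hτ.2

theorem J_sub_le_deviation (hH : 0 < H) (M : MDP S A H) {e : Fin H → S → A}
    (he : ∀ h, Measurable (e h)) {μ : ℝ} (hμ : Recoverable M (deterministicPolicy e he) μ)
    (π : Policy S A H) (hdev : deviation M e π ≠ ∞) :
    J M (deterministicPolicy e he) - J M π ≤ μ * H * (deviation M e π).toReal := by
  have h1 := lexpectedReturn_deterministic_le hH M he hμ π
  have h2 : ENNReal.ofReal μ * (H * deviation M e π) ≠ ∞ :=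
    ENNReal.mul_ne_top ENNReal.ofReal_ne_top (ENNReal.mul_ne_top (ENNReal.natCast_ne_top H) hdev)
  have h3 := ENNReal.toReal_mono (ENNReal.add_ne_top.2 ⟨lexpectedReturn_ne_top _, h2⟩) h1
  rw [ENNReal.toReal_add (lexpectedReturn_ne_top _) h2, ENNReal.toReal_mul, ENNReal.toReal_mul,
    ENNReal.toReal_ofReal (recoverable_nonneg hH M he hμ), ENNReal.toReal_natCast,
    ← expectedReturn_eq_toReal, ← expectedReturn_eq_toReal] at h3
  rw [J, J]
  linarith

theorem J_sub_eachStepMixture_le [Nonempty A] (M : MDP S A H)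
    {e : Fin H → S → A} (he : ∀ h, Measurable (e h)) {R : ℝ} (hR : NormalizedReturn M R)
    (C : Finset (Policy S A H)) {u : Policy S A H → ℝ≥0∞} (hu : ∑ π ∈ C, u π = 1) {ε : ℝ}
    (hε0 : 0 ≤ ε)
    (hε : ∀ i : Fin H → Policy S A H, (∀ h, i h ∈ C) →
      (trajLaw M (deterministicPolicy e he)).real (disagreement e fun h => i h h) ≤ ε) :
    J M (deterministicPolicy e he) - J M (eachStepMixture C u) ≤ R * ε := by
  have h1 := lexpectedReturn_deterministic_le_eachStepMixture M he hR C hu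
    (ε := ENNReal.ofReal ε) fun i hi => by
      rw [← ofReal_measureReal]
      exact ENNReal.ofReal_le_ofReal (hε i hi)
  have h2 : ENNReal.ofReal R * ENNReal.ofReal ε ≠ ∞ :=
    ENNReal.mul_ne_top ENNReal.ofReal_ne_top ENNReal.ofReal_ne_top
  have h3 := ENNReal.toReal_mono (ENNReal.add_ne_top.2 ⟨lexpectedReturn_ne_top _, h2⟩) h1
  rw [ENNReal.toReal_add (lexpectedReturn_ne_top _) h2, ENNReal.toReal_mul,
    ENNReal.toReal_ofReal (normalizedReturn_nonneg (deterministicPolicy e he) hR),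
    ENNReal.toReal_ofReal hε0, ← expectedReturn_eq_toReal, ← expectedReturn_eq_toReal] at h3
  rw [J, J]
  linarith

theorem sub_expectedReturn_firstStepMixtureLaw_le (M : MDP S A H) {N : ℕ} (hN : 0 < N)
    (π : Fin N → Policy S A H) {a : ℝ} {x : Fin N → ℝ} (hx : ∀ n, a - J M (π n) ≤ x n) :
    a - expectedReturn (firstStepMixtureLaw M π) ≤ (∑ n, x n) / N := by
  have hN' : (N : ℝ) ≠ 0 := by exact_mod_cast hN.ne'
  have h1 : expectedReturn (firstStepMixtureLaw M π) = (∑ n, J M (π n)) / N := by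
    have h3 : lexpectedReturn (firstStepMixtureLaw M π) =
        (N : ℝ≥0∞)⁻¹ * ∑ n, lexpectedReturn (trajLaw M (π n)) := by
      rw [lexpectedReturn, firstStepMixtureLaw, lintegral_smul_measure,
        lintegral_finsetSum_measure, smul_eq_mul]
      rfl
    rw [expectedReturn_eq_toReal, h3, ENNReal.toReal_mul,
      ENNReal.toReal_sum (fun n _ => lexpectedReturn_ne_top (trajLaw M (π n))), ENNReal.toReal_inv,
      ENNReal.toReal_natCast, inv_mul_eq_div]
    congr 1
    exact Finset.sum_congr rfl fun n _ => (expectedReturn_eq_toReal _).symm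
  have h2 : a = (∑ _n : Fin N, a) / N := by
    simp only [Finset.sum_const, Finset.card_univ, Fintype.card_fin, nsmul_eq_mul]
    field_simp
  rw [h1]
  nth_rw 1 [h2]
  rw [← sub_div, ← Finset.sum_sub_distrib]
  gcongr with n
  exact hx n

variable [Nonempty A]

theorem one_le_sum_expWeight {N n : ℕ} {B : Finset (Policy S A H)} {d : Dataset S A H N}
    {e : Fin H → S → A} {he : ∀ h, Measurable (e h)} (hd : deterministicPolicy e he ∈ bcClass B d)
    {obs : Fin n → Obs S A H} (hobs : ∀ i, (obs i).2.2 = e (obs i).1 (obs i).2.1) :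
    1 ≤ ∑ π ∈ bcClass B d, expWeight π obs := by
  rw [← expWeight_deterministicPolicy he hobs]
  exact Finset.single_le_sum (f := fun π => expWeight π obs) (fun _ _ => zero_le) hd

/-- This case is separate because `log (2 / δ)` is not bounded by a multiple of `log (1 / δ)` as `δ`
tends to `1`. A class that contains only the expert plays the expert. -/
theorem deviation_eq_zero_of_card_eq_one (M : MDP S A H) {N n : ℕ} {B : Finset (Policy S A H)}
    {d : Dataset S A H N} {e : Fin H → S → A} {he : ∀ h, Measurable (e h)}
    (hd : deterministicPolicy e he ∈ bcClass B d) (hcard : (bcClass B d).card = 1)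
    {obs : Fin n → Obs S A H} (hobs : ∀ i, (obs i).2.2 = e (obs i).1 (obs i).2.1) :
    deviation M e (warmStaggerPolicy B d obs) = 0 := by
  have h0 : ∑ π ∈ bcClass B d, expWeight π obs ≠ 0 :=
    (zero_lt_one.trans_le (one_le_sum_expWeight hd hobs)).ne'
  have hu := sum_expWeight_div B d obs h0
  have h1 : ∀ h s, matchProb e (warmStaggerPolicy B d obs) h s = 1 := by
    intro h s
    rw [matchProb, warmStaggerPolicy, eachStepMixture_apply _ hu, ← hu]
    refine Finset.sum_congr rfl fun π hπ => ?_
    obtain rfl := Finset.card_le_one.1 hcard.le π hπ _ hd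
    simp [deterministicPolicy, Kernel.deterministic_apply]
  simp [deviation, h1]

variable [NeZero H]

/-- The expert's weight `1` alone makes the potential at least `exp (cumulative deviation) / card`.
-/
theorem cumulativeDeviation_le_log {M : MDP S A H} {N n : ℕ} {B : Finset (Policy S A H)}
    {d : Dataset S A H N} {e : Fin H → S → A} {he : ∀ h, Measurable (e h)}
    (hd : deterministicPolicy e he ∈ bcClass B d)
    {obs : Fin n → Obs S A H} (hobs : ∀ i, (obs i).2.2 = e (obs i).1 (obs i).2.1)
    {δ : ℝ} (hδ : 0 < δ) (hpot : potential M B e d obs ≤ ENNReal.ofReal (2 / δ)) :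
    (cumulativeDeviation M B e d obs).toReal ≤ Real.log (2 * ((bcClass B d).card / δ)) := by
  have hc : 0 < (bcClass B d).card := Finset.card_pos.2 ⟨_, hd⟩
  have hc' : ((bcClass B d).card : ℝ≥0∞) ≠ 0 := by exact_mod_cast hc.ne'
  have h1 : ENNReal.ofReal (Real.exp (cumulativeDeviation M B e d obs).toReal) ≤
      ENNReal.ofReal (2 * ((bcClass B d).card / δ)) := by
    calc ENNReal.ofReal (Real.exp (cumulativeDeviation M B e d obs).toReal)
        = (bcClass B d).card * (1 / (bcClass B d).card *
            ENNReal.ofReal (Real.exp (cumulativeDeviation M B e d obs).toReal)) := by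
          rw [← mul_assoc, ENNReal.mul_div_cancel hc' (ENNReal.natCast_ne_top _), one_mul]
      _ ≤ (bcClass B d).card * potential M B e d obs := by
          rw [potential]
          gcongr
          exact one_le_sum_expWeight hd hobs
      _ ≤ (bcClass B d).card * ENNReal.ofReal (2 / δ) := by gcongr
      _ = _ := by
          rw [← ENNReal.ofReal_natCast, ← ENNReal.ofReal_mul (by positivity)]
          congr 1
          ring
  have hpos : 0 < 2 * ((bcClass B d).card / δ) := by positivity
  rw [Real.le_log_iff_exp_le hpos]
  exact (ENNReal.ofReal_le_ofReal_iff hpos.le).1 h1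

/-- Markov's inequality at the final round; no maximal inequality is needed. -/
theorem measure_potential_ge_le (M : MDP S A H) (B : Finset (Policy S A H))
    {e : Fin H → S → A} (he : ∀ h, Measurable (e h)) (N n : ℕ) {δ : ℝ} (hδ : 0 < δ) :
    interactionLaw M B e he N n {ω | ENNReal.ofReal (2 / δ) ≤ potential M B e ω.1 ω.2} ≤
      ENNReal.ofReal (δ / 2) := by
  refine (meas_ge_le_lintegral_div (measurable_potential M B he N n).aemeasurable
    (by simpa using hδ) ENNReal.ofReal_ne_top).trans ?_
  refine (ENNReal.div_le_div_right (lintegral_potential_le_one M B he N n) _).trans ?_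
  rw [one_div, ← ENNReal.ofReal_inv_of_pos (by positivity), inv_div]

theorem log_two_mul_le {x δ : ℝ} (hx : 2 ≤ x) (hδ : 0 < δ) (hδ1 : δ < 1) :
    Real.log (2 * (x / δ)) ≤ 2 * Real.log (x / δ) := by
  have h1 : 2 ≤ x / δ := by
    rw [le_div_iff₀ hδ]
    nlinarith
  rw [Real.log_mul (by norm_num) (by positivity)]
  linarith [Real.log_le_log (by norm_num) h1]

/-- The regret bound on the event that the data come from the expert, that no undetected policy of
the completion often disagrees with the expert, and that the potential is small. -/
theorem J_sub_warmStaggerOutput_le {M : MDP S A H} {B : Finset (Policy S A H)}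
    {e : Fin H → S → A} {he : ∀ h, Measurable (e h)} (hB : deterministicPolicy e he ∈ B)
    {μ R : ℝ} (hμ : Recoverable M (deterministicPolicy e he) μ) (hR : NormalizedReturn M R)
    {N n : ℕ} (hN : 0 < N) (hn : 0 < n) {δ : ℝ} (hδ : 0 < δ) (hδ1 : δ < 1)
    {d : Dataset S A H N} {obs : Fin n → Obs S A H}
    (hd : ∀ i h, (d i h).2 = e h (d i h).1)
    (hobs : ∀ i, (obs i).2.2 = e (obs i).1 (obs i).2.1)
    (hoff : ∀ π ∈ eachStepCompletion B, (∀ i h, matchProb e π h (d i h).1 = 1) →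
      (trajLaw M (deterministicPolicy e he)).real (disagreement e π) ≤
        Real.log (2 * ((eachStepCompletion B).card / δ)) / N)
    (hpot : potential M B e d obs ≤ ENNReal.ofReal (2 / δ)) :
    J M (deterministicPolicy e he) - expectedReturn (warmStaggerOutput M B d obs) ≤
      2 * min (R * Real.log ((eachStepCompletion B).card / δ) / N)
        (μ * H * Real.log ((bcClass B d).card / δ) / n) := by
  have hbc := deterministicPolicy_mem_bcClass hB hd
  have hH : 0 < H := Nat.pos_of_ne_zero (NeZero.ne H)
  have hR0 := normalizedReturn_nonneg (deterministicPolicy e he) hR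
  have hμ0 := recoverable_nonneg hH M he hμ
  have hN' : (0 : ℝ) < N := by exact_mod_cast hN
  have hn' : (0 : ℝ) < n := by exact_mod_cast hn
  have hc1 : 1 ≤ (bcClass B d).card := Finset.card_pos.2 ⟨_, hbc⟩
  have hcc : (bcClass B d).card ≤ (eachStepCompletion B).card :=
    (card_bcClass_le B d).trans (card_le_card_eachStepCompletion B)
  have hlog : ∀ c : ℕ, 1 ≤ c → 0 ≤ Real.log (c / δ) := fun c hc => by
    have hc' : (1 : ℝ) ≤ c := by exact_mod_cast hc
    refine Real.log_nonneg ?_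
    rw [le_div_iff₀ hδ]
    linarith
  have hdev : J M (deterministicPolicy e he) - expectedReturn (warmStaggerOutput M B d obs) ≤
      μ * H * (cumulativeDeviation M B e d obs).toReal / n := by
    refine (sub_expectedReturn_firstStepMixtureLaw_le M hn _ fun m =>
      J_sub_le_deviation hH M he hμ _ (deviation_ne_top M e _)).trans (le_of_eq ?_)
    rw [cumulativeDeviation, ENNReal.toReal_sum fun m _ => deviation_ne_top M e _,
      Finset.mul_sum]
  -- Either the expert is alone and the regret is at most `0`, or both classes have at least two
  -- members and `log_two_mul_le` applies.
  rcases Nat.eq_or_lt_of_le hc1 with hone | htwo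
  · have hz : cumulativeDeviation M B e d obs = 0 :=
      Finset.sum_eq_zero fun m _ =>
        deviation_eq_zero_of_card_eq_one M hbc hone.symm fun i => hobs _
    rw [hz] at hdev
    refine hdev.trans ?_
    have h1 := hlog _ (hc1.trans hcc)
    have h2 := hlog _ hc1
    simp only [ENNReal.toReal_zero, mul_zero, zero_div]
    exact mul_nonneg zero_le_two (le_min (by positivity) (by positivity))
  · have hc2 : (2 : ℝ) ≤ (bcClass B d).card := by exact_mod_cast htwo
    have hB2 : (2 : ℝ) ≤ (eachStepCompletion B).card := by exact_mod_cast htwo.trans_le hcc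
    rw [mul_min_of_nonneg _ _ zero_le_two]
    refine le_min ?_ ?_
    · have hε0 : 0 ≤ Real.log (2 * ((eachStepCompletion B).card / δ)) / N := by
        have h1 : 2 ≤ (eachStepCompletion B).card / δ := by
          rw [le_div_iff₀ hδ]
          nlinarith
        exact div_nonneg (Real.log_nonneg (by linarith)) hN'.le
      have hstep : J M (deterministicPolicy e he) -
          expectedReturn (warmStaggerOutput M B d obs) ≤
          R * (Real.log (2 * ((eachStepCompletion B).card / δ)) / N) := by
        refine (sub_expectedReturn_firstStepMixtureLaw_le M hn _ fun m =>
          J_sub_eachStepMixture_le M he hR _ (sum_expWeight_div B d _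
            (zero_lt_one.trans_le (one_le_sum_expWeight hbc fun i => hobs _)).ne') hε0
            fun i hi => hoff _ (mem_eachStepCompletion fun h =>
              bcClass_subset B d (hi h)) fun j h =>
                matchProb_eq_one_of_mem_bcClass hd (hi h) j h).trans (le_of_eq ?_)
        simp only [Finset.sum_const, Finset.card_univ, Fintype.card_fin, nsmul_eq_mul]
        field_simp
      refine hstep.trans ?_
      calc R * (Real.log (2 * ((eachStepCompletion B).card / δ)) / N)
          ≤ R * (2 * Real.log ((eachStepCompletion B).card / δ) / N) := by
            gcongr
            exact log_two_mul_le hB2 hδ hδ1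
        _ = _ := by ring
    · refine hdev.trans ?_
      calc μ * H * (cumulativeDeviation M B e d obs).toReal / n
          ≤ μ * H * (2 * Real.log ((bcClass B d).card / δ)) / n := by
            gcongr
            exact (cumulativeDeviation_le_log hbc hobs hδ hpot).trans (log_two_mul_le hc2 hδ hδ1)
        _ = _ := by ring

theorem interactionLaw_regret_le {M : MDP S A H} {B : Finset (Policy S A H)}
    {e : Fin H → S → A} {he : ∀ h, Measurable (e h)} (hB : deterministicPolicy e he ∈ B)
    {μ R : ℝ} (hμ : Recoverable M (deterministicPolicy e he) μ) (hR : NormalizedReturn M R)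
    {N n : ℕ} (hN : 0 < N) (hn : 0 < n) {δ : ℝ} (hδ : 0 < δ) (hδ1 : δ < 1) :
    interactionLaw M B e he N n
        {ω | ¬ (J M (deterministicPolicy e he) - expectedReturn (warmStaggerOutput M B ω.1 ω.2) ≤
          2 * min (R * Real.log ((eachStepCompletion B).card / δ) / N)
            (μ * H * Real.log ((bcClass B ω.1).card / δ) / n))}
      ≤ ENNReal.ofReal δ := by
  -- This `ε` makes the union bound `card * exp (-(N * ε))` equal to `δ / 2`.
  set ε := Real.log (2 * ((eachStepCompletion B).card / δ)) / N with hε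
  have hN' : (0 : ℝ) < N := by exact_mod_cast hN
  have hK : (0 : ℝ) < (eachStepCompletion B).card := by
    exact_mod_cast (Finset.card_pos.2 ⟨_, hB⟩).trans_le (card_le_card_eachStepCompletion B)
  obtain ⟨hm, hoff⟩ := offlineLaw_undetected_le M he (eachStepCompletion B) N ε
  set U := {d : Dataset S A H N | ∃ π ∈ eachStepCompletion B,
        ε < (trajLaw M (deterministicPolicy e he)).real (disagreement e π) ∧
          ∀ i h, matchProb e π h (d i h).1 = 1} with hU
  have hUδ : interactionLaw M B e he N n (Prod.fst ⁻¹' U) ≤ ENNReal.ofReal (δ / 2) := by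
    rw [interactionLaw_preimage_fst M B he N n hm]
    refine hoff.trans (le_of_eq ?_)
    congr 1
    rw [hε, mul_div_cancel₀ _ hN'.ne', Real.exp_neg, Real.exp_log (by positivity)]
    field_simp
  have hsplit : ENNReal.ofReal δ = ENNReal.ofReal (δ / 2) + ENNReal.ofReal (δ / 2) := by
    rw [← ENNReal.ofReal_add (by positivity) (by positivity), add_halves]
  rw [hsplit]
  -- Up to a null set, the failure event lies in the union of the two bad events, so its own
  -- measurability plays no role.
  refine le_trans (measure_mono_ae ?_) ((measure_union_le _ _).trans
    (add_le_add hUδ (measure_potential_ge_le M B he N n hδ)))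
  filter_upwards [ae_interactionLaw_data M B he N n, ae_interactionLaw_annotation M B he N n]
    with ω hd hobs hω
  by_contra hgood
  have hg1 : ω.1 ∉ U := fun h => hgood (Or.inl h)
  have hg2 : ¬ ENNReal.ofReal (2 / δ) ≤ potential M B e ω.1 ω.2 := fun h => hgood (Or.inr h)
  refine hω (J_sub_warmStaggerOutput_le hB hμ hR hN hn hδ hδ1 hd hobs (fun π hπ hc => ?_)
    (not_le.1 hg2).le)
  by_contra hlt
  exact hg1 ⟨π, hπ, not_le.1 hlt, hc⟩

end Regret

end HybridIL

/-! ### The main theorem -/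

open HybridIL in
theorem mainTheorem2 :
    ∃ c : ℝ, 0 < c ∧
      ∀ (S A : Type*) [MeasurableSpace S] [MeasurableSpace A] [MeasurableEq A] [Nonempty A]
        (H : ℕ) (_ : 0 < H) (M : MDP S A H) (B : Finset (Policy S A H))
        (e : Fin H → S → A) (he : ∀ h, Measurable (e h))
        (_ : deterministicPolicy e he ∈ B)
        (μ R : ℝ) (_ : Recoverable M (deterministicPolicy e he) μ) (_ : NormalizedReturn M R)
        (Noff Nint : ℕ) (_ : 0 < Noff) (_ : 0 < Nint) (δ : ℝ) (_ : 0 < δ) (_ : δ < 1),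
        interactionLaw M B e he Noff Nint
            {ω | ¬ (J M (deterministicPolicy e he)
                    - expectedReturn (warmStaggerOutput M B ω.1 ω.2)
                  ≤ c * min (R * Real.log ((eachStepCompletion B).card / δ) / Noff)
                      (μ * H * Real.log ((bcClass B ω.1).card / δ) / Nint))}
          ≤ ENNReal.ofReal δ
        ∧ B.card ≤ (eachStepCompletion B).card
        ∧ (eachStepCompletion B).card ≤ B.card ^ H
        ∧ ∀ d : Dataset S A H Noff, (bcClass B d).card ≤ B.card := by
  -- The constant `2` is the one from `log (2 * x / δ) ≤ 2 * log (x / δ)` for `x ≥ 2`.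
  refine ⟨2, two_pos, ?_⟩
  intro S A _ _ _ _ H hH M B e he hB μ R hμ hR Noff Nint hoff hint δ hδ hδ1
  have : NeZero H := ⟨hH.ne'⟩
  exact ⟨interactionLaw_regret_le hB hμ hR hoff hint hδ hδ1, card_le_card_eachStepCompletion B,
    card_eachStepCompletion_le B, card_bcClass_le B⟩
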